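/- Let $M$ be a nonempty compact complex manifold of complex dimension $n$ and let $1\le p\le n-1$, $k=n-p$. For an integer $m\geq 0$ put $\sigma_m=i^{m^2}2^{-m}$. A $(k,0)$-form at a point $x$ is called simple if it equals $\psi^1\wedge\dots\wedge\psi^k$ for some $(1,0)$-covectors $\psi^1,\dots,\psi^k$ at $x$; a form on $M$ is simple if it is simple at every point. A real $(p,p)$-covector $\Omega$ at $x$ is called transverse if, for every simple $(k,0)$-covector $\beta\neq 0$ at $x$, the top-degree form $\sigma_{k}\,\Omega\wedge\beta\wedge\bar\beta$ is strictly positive, i.e. a positive real multiple of the volume form $\sigma_n\,\varphi^1\wedge\dots\wedge\varphi^n\wedge\bar\varphi^1\wedge\dots\wedge\bar\varphi^n$, where $\varphi^1,\dots,\varphi^n$ is a basis of the $(1,0)$-covectors at $x$. Let $\Psi$ be a $p$-symplectic structure on $M$, that is, a smooth real $d$-closed $2p$-form whose $(p,p)$-component is transverse at every point. If the de Rham class $[\Psi]_{dR}$ vanishes, i.e. $\Psi=d\eta$ for some smooth (complex-valued) $(2p-1)$-form $\eta$ on $M$, then there is no smooth simple $(k,0)$-form $\xi$ on $M$ that vanishes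 at no point and satisfies $\partial\xi=\bar\partial\xi=0$. -/

import Mathlib

open scoped Manifold ContDiff Topology

noncomputable section

/-! ### Complex-valued exterior algebra of a complex vector space

`V` is a complex topological vector space (a tangent space of a complex manifold); an `r`-form on
`V` is a *real*-multilinear alternating map with values in `ℂ`, i.e. an element of `Λ^r(V* ⊗ ℂ)`. -/

namespace PSymp

section Pointwise

set_option linter.unusedSectionVars false

variable {V : Type*} [AddCommGroup V] [Module ℂ V] [TopologicalSpace V]
  [IsTopologicalAddGroup V] [ContinuousSMul ℂ V]

/-- The tensor product of two forms as a multilinear map: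
`(v₁, …, v_{r+s}) ↦ α(v₁, …, v_r) β(v_{r+1}, …, v_{r+s})`. -/
def tensorMul {r s : ℕ} (α : V [⋀^Fin r]→L[ℝ] ℂ) (β : V [⋀^Fin s]→L[ℝ] ℂ) :
    ContinuousMultilinearMap ℝ (fun _ : Fin (r + s) => V) ℂ where
  toFun v := α (fun i => v (Fin.castAdd s i)) * β (fun j => v (Fin.natAdd r j))
  map_update_add' := by
    intro inst v i x y
    obtain rfl : inst = instDecidableEqFin (r + s) := Subsingleton.elim _ _
    refine Fin.addCases (fun i => ?_) (fun i => ?_) i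
    · have h (z : V) : (fun k => Function.update v (Fin.castAdd s i) z (Fin.castAdd s k))
          = Function.update (fun k => v (Fin.castAdd s k)) i z := by
        ext k; by_cases hk : k = i
        · subst hk; simp
        · rw [Function.update_of_ne (by simpa [Fin.ext_iff] using hk), Function.update_of_ne hk]
      have h' (z : V) : (fun k => Function.update v (Fin.castAdd s i) z (Fin.natAdd r k))
          = fun k => v (Fin.natAdd r k) := by
        ext k; rw [Function.update_of_ne]; simp [Fin.ext_iff]; omega
      simp only [h, h']
      simp only [ContinuousAlternatingMap.map_update_add, add_mul]
    · have h (z : V) : (fun k => Function.update v (Fin.natAdd r i) z (Fin.natAdd r k))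
          = Function.update (fun k => v (Fin.natAdd r k)) i z := by
        ext k; by_cases hk : k = i
        · subst hk; simp
        · rw [Function.update_of_ne (by simpa [Fin.ext_iff] using hk), Function.update_of_ne hk]
      have h' (z : V) : (fun k => Function.update v (Fin.natAdd r i) z (Fin.castAdd s k))
          = fun k => v (Fin.castAdd s k) := by
        ext k; rw [Function.update_of_ne]; simp [Fin.ext_iff]; omega
      simp only [h, h']
      simp only [ContinuousAlternatingMap.map_update_add, mul_add]
  map_update_smul' := by
    intro inst v i c x
    obtain rfl : inst = instDecidableEqFin (r + s) := Subsingleton.elim _ _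
    refine Fin.addCases (fun i => ?_) (fun i => ?_) i
    · have h (z : V) : (fun k => Function.update v (Fin.castAdd s i) z (Fin.castAdd s k))
          = Function.update (fun k => v (Fin.castAdd s k)) i z := by
        ext k; by_cases hk : k = i
        · subst hk; simp
        · rw [Function.update_of_ne (by simpa [Fin.ext_iff] using hk), Function.update_of_ne hk]
      have h' (z : V) : (fun k => Function.update v (Fin.castAdd s i) z (Fin.natAdd r k))
          = fun k => v (Fin.natAdd r k) := by
        ext k; rw [Function.update_of_ne]; simp [Fin.ext_iff]; omega
      simp only [h, h']
      simp only [ContinuousAlternatingMap.map_update_smul, smul_mul_assoc]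
    · have h (z : V) : (fun k => Function.update v (Fin.natAdd r i) z (Fin.natAdd r k))
          = Function.update (fun k => v (Fin.natAdd r k)) i z := by
        ext k; by_cases hk : k = i
        · subst hk; simp
        · rw [Function.update_of_ne (by simpa [Fin.ext_iff] using hk), Function.update_of_ne hk]
      have h' (z : V) : (fun k => Function.update v (Fin.natAdd r i) z (Fin.castAdd s k))
          = fun k => v (Fin.castAdd s k) := by
        ext k; rw [Function.update_of_ne]; simp [Fin.ext_iff]; omega
      simp only [h, h']
      simp only [ContinuousAlternatingMap.map_update_smul, mul_smul_comm]
  cont := by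
    refine Continuous.mul ?_ ?_
    · exact α.cont.comp (by fun_prop)
    · exact β.cont.comp (by fun_prop)

/-- The wedge product, `α ∧ β = (1 / (r! s!)) ∑_σ sgn(σ) (α ⊗ β)(v_{σ(1)}, …, v_{σ(r+s)})`. -/
def wedge {r s : ℕ} (α : V [⋀^Fin r]→L[ℝ] ℂ) (β : V [⋀^Fin s]→L[ℝ] ℂ) :
    V [⋀^Fin (r + s)]→L[ℝ] ℂ :=
  (((r.factorial : ℂ) * (s.factorial : ℂ))⁻¹) •
    ContinuousMultilinearMap.alternatization (tensorMul α β)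

/-- The complex conjugate of a form. -/
def conj {r : ℕ} (α : V [⋀^Fin r]→L[ℝ] ℂ) : V [⋀^Fin r]→L[ℝ] ℂ :=
  (Complex.conjCLE : ℂ →L[ℝ] ℂ).compContinuousAlternatingMap α

/-- `ψ¹ ∧ … ∧ ψᵏ` for `ψ¹, …, ψᵏ ∈ Λ^{1,0}`. An element of `Λ^{1,0}` is a real-linear functional
`V → ℂ` whose complex-linear extension kills `T^{0,1}`, i.e. a `ℂ`-linear functional on `V`. The
wedge is the antisymmetrization `∑_σ sgn(σ) ∏_j ψʲ(v_{σ(j)})` of `ψ¹ ⊗ … ⊗ ψᵏ`. -/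
def wedgeOneZero {k : ℕ} (ψ : Fin k → (V →L[ℂ] ℂ)) : V [⋀^Fin k]→L[ℝ] ℂ :=
  ContinuousMultilinearMap.alternatization
    ((ContinuousMultilinearMap.mkPiAlgebra ℝ (Fin k) ℂ).compContinuousLinearMap
      (fun j => (ψ j).restrictScalars ℝ))

/-- A `(k,0)`-form is simple if it is a wedge product of `k` forms of type `(1,0)`. -/
def IsSimple {k : ℕ} (β : V [⋀^Fin k]→L[ℝ] ℂ) : Prop :=
  ∃ ψ : Fin k → (V →L[ℂ] ℂ), β = wedgeOneZero ψ

/-- Multiplication by `i` (the complex structure `J`) as a real-linear map. -/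
def J : V →L[ℝ] V :=
  (Complex.I • ContinuousLinearMap.id ℂ V).restrictScalars ℝ

/-- The value at `(v₁, …, v_r)` is `α(w₁, …, w_r)` (`α` extended complex-multilinearly to `V ⊗ ℂ`)
where `w_j = (v_j - i J v_j) / 2` is the `(1,0)`-part of `v_j` if `j ∈ S`, and
`w_j = (v_j + i J v_j) / 2` is the `(0,1)`-part of `v_j` if `j ∉ S`; here it is expanded by
multilinearity, `T` being the set of slots in which the `J`-summand is chosen. -/
def evalParts {r : ℕ} (S : Finset (Fin r)) (α : V [⋀^Fin r]→L[ℝ] ℂ) :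
    ContinuousMultilinearMap ℝ (fun _ : Fin r => V) ℂ :=
  ((2 : ℂ) ^ r)⁻¹ • ∑ T : Finset (Fin r),
    (∏ j ∈ T, if j ∈ S then -Complex.I else Complex.I) •
      α.toContinuousMultilinearMap.compContinuousLinearMap
        (fun j => if j ∈ T then J else ContinuousLinearMap.id ℝ V)

theorem evalParts_apply {r : ℕ} (S : Finset (Fin r)) (α : V [⋀^Fin r]→L[ℝ] ℂ) (v : Fin r → V) :
    evalParts S α v = ((2 : ℂ) ^ r)⁻¹ * ∑ T : Finset (Fin r),
      (∏ j ∈ T, if j ∈ S then -Complex.I else Complex.I) *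
        α (fun j => if j ∈ T then Complex.I • v j else v j) := by
  simp only [evalParts, smul_apply, sum_apply,
    smul_eq_mul, ContinuousMultilinearMap.compContinuousLinearMap_apply]
  congr 1
  refine Finset.sum_congr rfl fun T _ => ?_
  congr 1
  change α _ = α _
  congr 1
  ext j
  split_ifs <;> simp [J]

theorem evalParts_swap {r : ℕ} (S : Finset (Fin r)) (α : V [⋀^Fin r]→L[ℝ] ℂ) (v : Fin r → V)
    {i j : Fin r} (hv : v i = v j) (hij : i ≠ j) :
    evalParts ((Equiv.swap i j).finsetCongr S) α v = -evalParts S α v := by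
  have hmem (T : Finset (Fin r)) (l : Fin r) :
      l ∈ (Equiv.swap i j).finsetCongr T ↔ Equiv.swap i j l ∈ T := by
    simp [Equiv.finsetCongr_apply, Finset.mem_map_equiv]
  have hvs (l : Fin r) : v (Equiv.swap i j l) = v l := by
    rcases eq_or_ne l i with rfl | h1
    · simp [hv]
    rcases eq_or_ne l j with rfl | h2
    · simp [hv]
    rw [Equiv.swap_apply_of_ne_of_ne h1 h2]
  rw [evalParts_apply, evalParts_apply, ← mul_neg, ← Finset.sum_neg_distrib]
  congr 1
  rw [← Equiv.sum_comp (Equiv.swap i j).finsetCongr]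
  refine Finset.sum_congr rfl fun T _ => ?_
  rw [← mul_neg]
  congr 1
  · rw [Equiv.finsetCongr_apply, Finset.prod_map]
    refine Finset.prod_congr rfl fun l _ => ?_
    simp
  · have hsw := α.toAlternatingMap.map_swap (fun l => if l ∈ T then Complex.I • v l else v l) hij
    change α _ = -α _ at hsw
    rw [← hsw]
    congr 1
    ext l
    simp only [Function.comp, hmem, hvs]

/-- The `(p,q)`-component `α^{p,q} ∈ Λ^{p,q}` of an `r`-form `α` (zero unless `p + q = r`):
`α^{p,q}(v₁, …, v_r)` is the sum, over all choices of `p` of the `r` slots, of the value of `α` on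
the `(1,0)`-parts of the vectors in the chosen slots and the `(0,1)`-parts of the others. -/
def typeComponent (p q : ℕ) {r : ℕ} (α : V [⋀^Fin r]→L[ℝ] ℂ) : V [⋀^Fin r]→L[ℝ] ℂ where
  toContinuousMultilinearMap :=
    ∑ S : Finset (Fin r) with S.card = p ∧ Sᶜ.card = q, evalParts S α
  map_eq_zero_of_eq' := by
    intro v i j hv hij
    change (∑ S : Finset (Fin r) with S.card = p ∧ Sᶜ.card = q, evalParts S α) v = 0
    rw [sum_apply]
    have key : ∑ S : Finset (Fin r) with S.card = p ∧ Sᶜ.card = q, evalParts S α v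
        = -∑ S : Finset (Fin r) with S.card = p ∧ Sᶜ.card = q, evalParts S α v := by
      rw [← Finset.sum_neg_distrib]
      symm
      refine Finset.sum_equiv (Equiv.swap i j).finsetCongr (fun S => ?_) (fun S _ => ?_)
      · simp [Equiv.finsetCongr_apply, Finset.card_compl]
      · exact (evalParts_swap S α v hv hij).symm
    exact self_eq_neg.mp key

/-- The constant `σ_p = i^{p²} 2^{-p}`. -/
def sigma (p : ℕ) : ℂ := Complex.I ^ (p ^ 2) * ((2 : ℂ) ^ p)⁻¹

/-- The volume form `σ_n φ¹ ∧ … ∧ φⁿ ∧ φ̄¹ ∧ … ∧ φ̄ⁿ` of a coframe `φ¹, …, φⁿ` of type `(1,0)`. -/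
def volForm {n : ℕ} (φ : Fin n → (V →L[ℂ] ℂ)) : V [⋀^Fin (n + n)]→L[ℝ] ℂ :=
  sigma n • wedge (wedgeOneZero φ) (conj (wedgeOneZero φ))

/-- A form `τ` of degree `m` is a strictly positive top form on an `n`-dimensional `V`:
`m = 2n` and `τ = a Vol` with `a > 0`, where `Vol` is the volume form of a basis of `Λ^{1,0}`
(another basis changes `Vol` by a positive factor). -/
def IsStrictlyPositive (n : ℕ) {m : ℕ} (τ : V [⋀^Fin m]→L[ℝ] ℂ) : Prop :=
  ∃ (h : n + n = m) (φ : Module.Basis (Fin n) ℂ (V →L[ℂ] ℂ)) (a : ℝ), 0 < a ∧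
    ∀ v : Fin m → V, τ v = (a : ℂ) * volForm (fun i => φ i) (fun i => v (Fin.cast h i))

/-- Transversality of a `(p,p)`-form `Ω` on an `n`-dimensional complex vector space:
`σ_{n-p} Ω ∧ β ∧ β̄` is strictly positive for every simple `β ≠ 0` in `Λ^{n-p,0}`. -/
def IsTransverse (n p : ℕ) (Ω : V [⋀^Fin (2 * p)]→L[ℝ] ℂ) : Prop :=
  ∀ β : V [⋀^Fin (n - p)]→L[ℝ] ℂ, IsSimple β → β ≠ 0 →
    IsStrictlyPositive n (sigma (n - p) • wedge (wedge Ω β) (conj β))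

end Pointwise

/-! ### Differential forms on a complex manifold -/

section Forms

variable {E : Type*} [NormedAddCommGroup E] [NormedSpace ℂ E]
  {M : Type*} [TopologicalSpace M] [ChartedSpace E M]

variable (E M) in
/-- Complex-valued `r`-forms on `M` (not necessarily smooth). -/
abbrev Form (r : ℕ) : Type _ :=
  ∀ x : M, TangentSpace 𝓘(ℂ, E) x [⋀^Fin r]→L[ℝ] ℂ

/-- The expression of a form in a chart `e` of `M`: its pullback under `e⁻¹`
(meaningful on the open set `e.target`). -/
def chartForm {r : ℕ} (e : OpenPartialHomeomorph M E) (α : Form E M r) :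
    E → E [⋀^Fin r]→L[ℝ] ℂ :=
  fun y => (α (e.symm y)).compContinuousLinearMap
    ((mfderiv 𝓘(ℂ, E) 𝓘(ℂ, E) e.symm y).restrictScalars ℝ : E →L[ℝ] TangentSpace 𝓘(ℂ, E) (e.symm y))

/-- Smoothness (in the real sense) of a form: it is `C^∞` in every chart. -/
def IsSmooth {r : ℕ} (α : Form E M r) : Prop :=
  ∀ e ∈ atlas E M, ContDiffOn ℝ ∞ (chartForm e α) e.target

/-- The exterior derivative `d`, computed at `x` in the preferred chart around `x`. -/
def d {r : ℕ} (α : Form E M r) : Form E M (r + 1) :=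
  fun x => (extDeriv (chartForm (chartAt E x) α) (chartAt E x x)).compContinuousLinearMap
    ((mfderiv 𝓘(ℂ, E) 𝓘(ℂ, E) (chartAt E x) x).restrictScalars ℝ : TangentSpace 𝓘(ℂ, E) x →L[ℝ] E)

/-- `∂` on forms of type `(p,q)`: the `(p+1,q)`-component of `d`. -/
def del (p q : ℕ) {r : ℕ} (α : Form E M r) : Form E M (r + 1) :=
  fun x => typeComponent (p + 1) q (d α x)

/-- `∂̄` on forms of type `(p,q)`: the `(p,q+1)`-component of `d`. -/
def delbar (p q : ℕ) {r : ℕ} (α : Form E M r) : Form E M (r + 1) :=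
  fun x => typeComponent p (q + 1) (d α x)

/-- The de Rham class of `α` vanishes: `α = dη` for a smooth form `η` of degree one less. -/
def IsExact {r : ℕ} (α : Form E M r) : Prop :=
  ∃ (s : ℕ) (h : r = s + 1) (η : Form E M s), IsSmooth η ∧
    ∀ (x : M) (v : Fin (s + 1) → TangentSpace 𝓘(ℂ, E) x),
      d η x v = α x (fun i => v (Fin.cast h i))

/-- `Ψ` is a `p`-symplectic structure on the `n`-dimensional complex manifold `M`: a smooth, real,
`d`-closed `2p`-form whose `(p,p)`-component is transverse at every point. -/
structure IsPSymplectic (n p : ℕ) (Ψ : Form E M (2 * p)) : Prop where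
  smooth : IsSmooth Ψ
  real : ∀ x, conj (Ψ x) = Ψ x
  closed : ∀ x, d Ψ x = 0
  transverse : ∀ x, IsTransverse n p (typeComponent p p (Ψ x))

end Forms

end PSymp

end

/-! Suppose such a `ξ` exists. A simple form is `ℂ`-linear in each argument, so its differential has
components only of types (k+1,0) and (k,1); these are `∂ξ` and `∂̄ξ`, hence `ξ` and its conjugate
are closed. If `Ψ = dη`, the Leibniz rule gives `Ψ ∧ ξ ∧ ξ̄ = d(η ∧ ξ ∧ ξ̄)`, and by Stokes its
integral over the compact manifold is zero. On the other hand, for reasons of type only `Ψ^{p,p}`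
contributes to this top form, so transversality makes it, up to the constant `σ_k⁻¹`, a positive
multiple of the volume form at every point. Its integral, divided by that constant, is therefore
positive: a contradiction.

The type argument (`wedge_typeComponent`) uses the circle action. A unit scalar `c` acts on an
(a,b)-component by `c^a c̄^b`, while a top form is invariant because scalar multiplication by `c`
has real determinant 1. A product of nontrivial weight thus vanishes.

Orientation enters through one fact, `top_form_comp`: a `ℂ`-linear map `A` acts on top forms by
`|det A|²`. This makes different coframes and different charts agree up to positive factors, and it
is also the Jacobian in the change of variables. Integration is done on chart coefficients, and
`not_forall_d_pos` glues local Stokes by a partition of unity. -/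

noncomputable section

set_option linter.unusedSectionVars false

namespace PSymp

/-! ### Signed sums over permutations. -/

section AltSum

variable {V : Type*}

/-- The signed sum of a function of `m` vectors over all permutations of its arguments. -/
def altSum {m : ℕ} (T : (Fin m → V) → ℂ) (v : Fin m → V) : ℂ :=
  ∑ σ : Equiv.Perm (Fin m), ((Equiv.Perm.sign σ : ℤ) : ℂ) * T (v ∘ σ)

/-- The tensor product of two functions of `r` and `s` vectors. -/
def tens {r s : ℕ} (f : (Fin r → V) → ℂ) (g : (Fin s → V) → ℂ) (v : Fin (r + s) → V) : ℂ :=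
  f (v ∘ Fin.castAdd s) * g (v ∘ Fin.natAdd r)

theorem sign_mul_sign_cast {m : ℕ} (σ : Equiv.Perm (Fin m)) :
    ((Equiv.Perm.sign σ : ℤ) : ℂ) * ((Equiv.Perm.sign σ : ℤ) : ℂ) = 1 := by
  rcases Int.units_eq_one_or (Equiv.Perm.sign σ) with h | h <;> simp [h]

/-- Reindex by right multiplication with `τ`; the sign of `τ` squares to 1. All later sign
bookkeeping reduces to this. -/
theorem altSum_comp_perm {m : ℕ} (T : (Fin m → V) → ℂ) (τ : Equiv.Perm (Fin m)) (v : Fin m → V) :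
    altSum (fun w => T (w ∘ τ)) v = ((Equiv.Perm.sign τ : ℤ) : ℂ) * altSum T v := by
  unfold altSum
  rw [Finset.mul_sum, ← Equiv.sum_comp (Equiv.mulRight τ) (fun σ => _ * (_ * T (v ∘ σ)))]
  refine Finset.sum_congr rfl fun σ _ => ?_
  have h := sign_mul_sign_cast τ
  simp only [Equiv.coe_mulRight, Equiv.Perm.sign_mul, Units.val_mul, Int.cast_mul,
    Equiv.Perm.coe_mul, Function.comp_assoc]
  linear_combination (-((Equiv.Perm.sign σ : ℤ) : ℂ) * T (v ∘ σ ∘ τ)) * h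

theorem altSum_cast {m m' : ℕ} (h : m = m') (T : (Fin m → V) → ℂ) (v : Fin m' → V) :
    altSum (fun w => T (w ∘ Fin.cast h)) v = altSum T (v ∘ Fin.cast h) := by
  subst h; rfl

theorem altSum_const_mul {m : ℕ} (c : ℂ) (T : (Fin m → V) → ℂ) (v : Fin m → V) :
    altSum (fun w => c * T w) v = c * altSum T v := by
  simp only [altSum, Finset.mul_sum]
  exact Finset.sum_congr rfl fun σ _ => by ring

theorem altSum_sum {m : ℕ} {ι : Type*} (s : Finset ι) (T : ι → (Fin m → V) → ℂ) (v : Fin m → V) :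
    altSum (fun w => ∑ i ∈ s, T i w) v = ∑ i ∈ s, altSum (T i) v := by
  simp only [altSum, Finset.mul_sum]
  exact Finset.sum_comm

theorem altSum_add {m : ℕ} (S T : (Fin m → V) → ℂ) (v : Fin m → V) :
    altSum (fun w => S w + T w) v = altSum S v + altSum T v := by
  simp only [altSum, mul_add, Finset.sum_add_distrib]

/-- A permutation of the first `r` of `r + s` indices. -/
def permLeft {r : ℕ} (s : ℕ) (τ : Equiv.Perm (Fin r)) : Equiv.Perm (Fin (r + s)) :=
  finSumFinEquiv.permCongr (Equiv.sumCongr τ (1 : Equiv.Perm (Fin s)))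

/-- A permutation of the last `s` of `r + s` indices. -/
def permRight (r : ℕ) {s : ℕ} (τ : Equiv.Perm (Fin s)) : Equiv.Perm (Fin (r + s)) :=
  finSumFinEquiv.permCongr (Equiv.sumCongr (1 : Equiv.Perm (Fin r)) τ)

theorem sign_permLeft {r : ℕ} (s : ℕ) (τ : Equiv.Perm (Fin r)) :
    Equiv.Perm.sign (permLeft s τ) = Equiv.Perm.sign τ := by
  simp only [permLeft, Equiv.Perm.sign_permCongr]
  exact (Equiv.Perm.sign_sumCongr τ 1).trans (by simp)

theorem sign_permRight (r : ℕ) {s : ℕ} (τ : Equiv.Perm (Fin s)) :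
    Equiv.Perm.sign (permRight r τ) = Equiv.Perm.sign τ := by
  simp only [permRight, Equiv.Perm.sign_permCongr]
  exact (Equiv.Perm.sign_sumCongr 1 τ).trans (by simp)

theorem tens_comp_left {r s : ℕ} (f : (Fin r → V) → ℂ) (g : (Fin s → V) → ℂ)
    (τ : Equiv.Perm (Fin r)) (v : Fin (r + s) → V) :
    tens (fun w => f (w ∘ τ)) g v = tens f g (v ∘ permLeft s τ) := by
  unfold tens
  refine congrArg₂ (· * ·) (congrArg f (funext fun j => ?_)) (congrArg g (funext fun j => ?_)) <;>
    simp [permLeft, Equiv.permCongr_apply]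

theorem tens_comp_right {r s : ℕ} (f : (Fin r → V) → ℂ) (g : (Fin s → V) → ℂ)
    (τ : Equiv.Perm (Fin s)) (v : Fin (r + s) → V) :
    tens f (fun w => g (w ∘ τ)) v = tens f g (v ∘ permRight r τ) := by
  unfold tens
  refine congrArg₂ (· * ·) (congrArg f (funext fun j => ?_)) (congrArg g (funext fun j => ?_)) <;>
    simp [permRight, Equiv.permCongr_apply]

theorem altSum_tens_comp_left {r s : ℕ} (f : (Fin r → V) → ℂ) (g : (Fin s → V) → ℂ)
    (τ : Equiv.Perm (Fin r)) (v : Fin (r + s) → V) :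
    altSum (tens (fun w => f (w ∘ τ)) g) v =
      ((Equiv.Perm.sign τ : ℤ) : ℂ) * altSum (tens f g) v := by
  rw [← sign_permLeft s τ, ← altSum_comp_perm]
  congr 1
  exact funext (tens_comp_left f g τ)

theorem altSum_tens_comp_right {r s : ℕ} (f : (Fin r → V) → ℂ) (g : (Fin s → V) → ℂ)
    (τ : Equiv.Perm (Fin s)) (v : Fin (r + s) → V) :
    altSum (tens f (fun w => g (w ∘ τ))) v =
      ((Equiv.Perm.sign τ : ℤ) : ℂ) * altSum (tens f g) v := by
  rw [← sign_permRight r τ, ← altSum_comp_perm]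
  congr 1
  exact funext (tens_comp_right f g τ)

/-- Antisymmetrizing one factor beforehand only multiplies the result by the number of terms. The
index type is left free because two cases occur: all permutations (wedge of wedges) and the `r + 1`
cycles that define the exterior derivative. -/
theorem altSum_tens_sum_left {r s : ℕ} {ι : Type*} [Fintype ι] (c : ι → ℂ)
    (τ : ι → Equiv.Perm (Fin r)) (hc : ∀ i, c i = ((Equiv.Perm.sign (τ i) : ℤ) : ℂ))
    (f : (Fin r → V) → ℂ) (g : (Fin s → V) → ℂ) (v : Fin (r + s) → V) :
    altSum (tens (fun w => ∑ i, c i * f (w ∘ τ i)) g) v =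
      Fintype.card ι * altSum (tens f g) v := by
  have h : tens (fun w => ∑ i, c i * f (w ∘ τ i)) g
      = fun v => ∑ i, c i * tens (fun w => f (w ∘ τ i)) g v := by
    ext v; simp only [tens, Finset.sum_mul, mul_assoc]
  rw [h, altSum_sum]
  simp only [altSum_const_mul, altSum_tens_comp_left, ← mul_assoc, hc, sign_mul_sign_cast]
  simp

theorem altSum_tens_sum_right {r s : ℕ} {ι : Type*} [Fintype ι] (c : ι → ℂ)
    (τ : ι → Equiv.Perm (Fin s)) (hc : ∀ i, c i = ((Equiv.Perm.sign (τ i) : ℤ) : ℂ))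
    (f : (Fin r → V) → ℂ) (g : (Fin s → V) → ℂ) (v : Fin (r + s) → V) :
    altSum (tens f (fun w => ∑ i, c i * g (w ∘ τ i))) v =
      Fintype.card ι * altSum (tens f g) v := by
  have h : tens f (fun w => ∑ i, c i * g (w ∘ τ i))
      = fun v => ∑ i, c i * tens f (fun w => g (w ∘ τ i)) v := by
    ext v; simp only [tens, Finset.mul_sum, mul_left_comm]
  rw [h, altSum_sum]
  simp only [altSum_const_mul, altSum_tens_comp_right, ← mul_assoc, hc, sign_mul_sign_cast]
  simp

/-- Expansion of a signed sum according to the vector in the first argument. -/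
theorem altSum_succ {m : ℕ} (T : (Fin (m + 1) → V) → ℂ) (v : Fin (m + 1) → V) :
    altSum T v = ∑ i : Fin (m + 1),
      (-1) ^ (i : ℕ) * altSum (fun w => T (Fin.cons (v i) w)) (i.removeNth v) := by
  -- Each permutation sending 0 to `i` is, uniquely, a permutation fixing 0 followed by the cycle
  -- that carries 0 to `i`; that cycle has sign `(-1)^i`.
  let F : Fin (m + 1) × Equiv.Perm (Fin m) → Equiv.Perm (Fin (m + 1)) :=
    fun q => q.1.cycleRange.symm * Equiv.Perm.decomposeFin.symm (0, q.2)
  have hF0 (q) : F q 0 = q.1 := by simp [F]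
  have hinj : Function.Injective F := by
    rintro ⟨i, e⟩ ⟨i', e'⟩ h
    obtain rfl : i = i' := (hF0 (i, e)).symm.trans ((congrArg (· 0) h).trans (hF0 (i', e')))
    have := mul_left_cancel h
    simpa using this
  have hbij : Function.Bijective F :=
    (Fintype.bijective_iff_injective_and_card F).2
      ⟨hinj, Fintype.card_congr Equiv.Perm.decomposeFin.symm⟩
  unfold altSum
  rw [← (Equiv.ofBijective F hbij).sum_comp, Fintype.sum_prod_type]
  refine Finset.sum_congr rfl fun i _ => ?_
  rw [Finset.mul_sum]
  refine Finset.sum_congr rfl fun e _ => ?_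
  have hs : ((Equiv.Perm.sign (F (i, e)) : ℤ) : ℂ)
      = (-1) ^ (i : ℕ) * ((Equiv.Perm.sign e : ℤ) : ℂ) := by
    simp [F, Fin.sign_cycleRange]
  have hv : v ∘ F (i, e) = Fin.cons (v i) (i.removeNth v ∘ e) := by
    ext j
    refine Fin.cases ?_ (fun j => ?_) j
    · simp [hF0]
    · simp [F, Fin.removeNth]
  simp only [Equiv.ofBijective_apply, hs, hv, mul_assoc]

end AltSum

/-! ### Wedge product, conjugation and pullback. -/

section WedgeAlgebra

variable {V : Type*} [AddCommGroup V] [Module ℂ V] [TopologicalSpace V]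
  [IsTopologicalAddGroup V] [ContinuousSMul ℂ V]
  {W : Type*} [AddCommGroup W] [Module ℂ W] [TopologicalSpace W]
  [IsTopologicalAddGroup W] [ContinuousSMul ℂ W]

theorem wedge_apply {r s : ℕ} (α : V [⋀^Fin r]→L[ℝ] ℂ) (β : V [⋀^Fin s]→L[ℝ] ℂ)
    (v : Fin (r + s) → V) :
    wedge α β v = ((r.factorial : ℂ) * (s.factorial : ℂ))⁻¹ * altSum (tens α β) v := by
  change ((r.factorial : ℂ) * (s.factorial : ℂ))⁻¹ *
    ContinuousMultilinearMap.alternatization (tensorMul α β) v = _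
  rw [ContinuousMultilinearMap.alternatization_apply_apply]
  congr 1
  refine Finset.sum_congr rfl fun σ _ => ?_
  rw [Units.smul_def, zsmul_eq_mul]
  rfl

theorem wedgeOneZero_apply {k : ℕ} (ψ : Fin k → (V →L[ℂ] ℂ)) (v : Fin k → V) :
    wedgeOneZero ψ v = altSum (fun w => ∏ j, ψ j (w j)) v := by
  unfold wedgeOneZero
  rw [ContinuousMultilinearMap.alternatization_apply_apply]
  refine Finset.sum_congr rfl fun σ _ => ?_
  rw [Units.smul_def, zsmul_eq_mul]
  simp

@[simp]
theorem conj_apply {r : ℕ} (α : V [⋀^Fin r]→L[ℝ] ℂ) (v : Fin r → V) :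
    conj α v = (starRingEnd ℂ) (α v) := rfl

theorem wedge_comp {r s : ℕ} (α : V [⋀^Fin r]→L[ℝ] ℂ) (β : V [⋀^Fin s]→L[ℝ] ℂ) (f : W →L[ℝ] V) :
    (wedge α β).compContinuousLinearMap f =
      wedge (α.compContinuousLinearMap f) (β.compContinuousLinearMap f) := by
  ext v
  rw [ContinuousAlternatingMap.compContinuousLinearMap_apply, wedge_apply, wedge_apply]
  rfl

theorem conj_comp {r : ℕ} (α : V [⋀^Fin r]→L[ℝ] ℂ) (f : W →L[ℝ] V) :
    (conj α).compContinuousLinearMap f = conj (α.compContinuousLinearMap f) := rfl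

/-- Serves to replace `dη`, of degree `s + 1`, by `Ψ`, of degree `2 * p`: the degrees agree only
propositionally. -/
theorem wedge_congr_cast {r r' s : ℕ} (h : r' = r) (α : V [⋀^Fin r]→L[ℝ] ℂ)
    (α' : V [⋀^Fin r']→L[ℝ] ℂ) (hα : ∀ v, α' v = α (fun i => v (Fin.cast h.symm i)))
    (β : V [⋀^Fin s]→L[ℝ] ℂ) (v : Fin (r' + s) → V) :
    wedge α' β v = wedge α β (fun i => v (Fin.cast (by rw [h]) i)) := by
  subst h
  obtain rfl : α' = α := by ext v; exact hα v
  rfl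

/-- The wedge product as a real-bilinear map. -/
def wedgeBilin (r s : ℕ) :
    (V [⋀^Fin r]→L[ℝ] ℂ) →ₗ[ℝ] (V [⋀^Fin s]→L[ℝ] ℂ) →ₗ[ℝ] V [⋀^Fin (r + s)]→L[ℝ] ℂ :=
  LinearMap.mk₂ ℝ wedge
    (fun α α' β => by
      ext v
      simp only [wedge_apply, ContinuousAlternatingMap.add_apply, ← mul_add, ← altSum_add]
      exact congrArg (fun T => _ * altSum T v) (funext fun w => by simp [tens, add_mul]))
    (fun c α β => by
      ext v
      simp only [wedge_apply, ContinuousAlternatingMap.smul_apply, Complex.real_smul]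
      rw [mul_left_comm, ← altSum_const_mul (c : ℂ)]
      exact congrArg (fun T => _ * altSum T v) (funext fun w => by simp [tens, mul_assoc]))
    (fun α β β' => by
      ext v
      simp only [wedge_apply, ContinuousAlternatingMap.add_apply, ← mul_add, ← altSum_add]
      exact congrArg (fun T => _ * altSum T v) (funext fun w => by simp [tens, mul_add]))
    (fun c α β => by
      ext v
      simp only [wedge_apply, ContinuousAlternatingMap.smul_apply, Complex.real_smul]
      rw [mul_left_comm, ← altSum_const_mul (c : ℂ)]
      exact congrArg (fun T => _ * altSum T v) (funext fun w => by simp [tens, mul_left_comm]))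

@[simp]
theorem wedgeBilin_apply {r s : ℕ} (α : V [⋀^Fin r]→L[ℝ] ℂ) (β : V [⋀^Fin s]→L[ℝ] ℂ) :
    wedgeBilin r s α β = wedge α β := rfl

end WedgeAlgebra

/-! ### Splitting arguments into (1,0)- and (0,1)-parts. -/

section PartSum

variable {V : Type*} [AddCommGroup V] [Module ℂ V]
  {W : Type*} [AddCommGroup W] [Module ℂ W]

/-- Multiplication by `i` of the vectors in the slots of `T`. -/
def twist {r : ℕ} (T : Finset (Fin r)) (v : Fin r → V) : Fin r → V :=
  fun j => if j ∈ T then Complex.I • v j else v j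

/-- The evaluation of a function on `(1,0)`-parts in the slots of `S` and on `(0,1)`-parts in
the others, expanded by multilinearity. -/
def partSum {r : ℕ} (S : Finset (Fin r)) (f : (Fin r → V) → ℂ) (v : Fin r → V) : ℂ :=
  ((2 : ℂ) ^ r)⁻¹ * ∑ T : Finset (Fin r),
    (∏ j ∈ T, if j ∈ S then -Complex.I else Complex.I) * f (twist T v)

/-- Adding or removing one element, as a permutation of the subsets. -/
def toggle {r : ℕ} (j : Fin r) : Equiv.Perm (Finset (Fin r)) :=
  Function.Involutive.toPerm (fun T => symmDiff T {j}) fun T => by simp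

theorem toggle_of_mem {r : ℕ} {j : Fin r} {T : Finset (Fin r)} (h : j ∈ T) :
    toggle j T = T.erase j := by
  ext l
  change l ∈ symmDiff T {j} ↔ _
  by_cases hl : l = j <;> simp [Finset.mem_symmDiff, hl, h]

theorem toggle_of_notMem {r : ℕ} {j : Fin r} {T : Finset (Fin r)} (h : j ∉ T) :
    toggle j T = insert j T := by
  ext l
  change l ∈ symmDiff T {j} ↔ _
  by_cases hl : l = j <;> simp [Finset.mem_symmDiff, hl, h]

/-- Subsets with and without `j` cancel in pairs. -/
theorem sum_eq_zero_of_toggle {r : ℕ} (j : Fin r) (F : Finset (Fin r) → ℂ)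
    (h : ∀ T, j ∉ T → F (insert j T) = -F T) : ∑ T, F T = 0 := by
  have key : ∑ T, F T = -∑ T, F T := by
    rw [← Finset.sum_neg_distrib, ← Equiv.sum_comp (toggle j)]
    refine Finset.sum_congr rfl fun T _ => ?_
    by_cases hT : j ∈ T
    · have := h (T.erase j) (Finset.notMem_erase j T)
      rw [Finset.insert_erase hT] at this
      rw [toggle_of_mem hT, this, neg_neg]
    · rw [toggle_of_notMem hT, h T hT]
  exact self_eq_neg.mp key

theorem twist_insert {r : ℕ} {j : Fin r} {T : Finset (Fin r)} (h : j ∉ T) (v : Fin r → V) :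
    twist (insert j T) v = Function.update (twist T v) j (Complex.I • twist T v j) := by
  ext l
  by_cases hl : l = j
  · subst hl; simp [twist, h]
  · simp [twist, hl]

theorem twist_update {r : ℕ} {j : Fin r} {T : Finset (Fin r)} (v : Fin r → V) :
    twist T (Function.update v j (Complex.I • v j)) =
      Function.update (twist T v) j (Complex.I • twist T v j) := by
  ext l
  by_cases hl : l = j
  · subst hl; simp [twist]
  · simp [twist, hl]

theorem partSum_comp {r : ℕ} (S : Finset (Fin r)) (f : (Fin r → V) → ℂ) (D : W →ₗ[ℂ] V)
    (v : Fin r → W) : partSum S (fun w => f (D ∘ w)) v = partSum S f (D ∘ v) := by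
  unfold partSum
  congr 1
  refine Finset.sum_congr rfl fun T _ => ?_
  refine congrArg (fun w => _ * f w) (funext fun j => ?_)
  by_cases hj : j ∈ T <;> simp [twist, hj]

theorem partSum_sum {r : ℕ} (S : Finset (Fin r)) {ι : Type*} (s : Finset ι) (c : ι → ℂ)
    (f : ι → (Fin r → V) → ℂ) (v : Fin r → V) :
    partSum S (fun w => ∑ i ∈ s, c i * f i w) v = ∑ i ∈ s, c i * partSum S (f i) v := by
  simp only [partSum, Finset.mul_sum]
  rw [Finset.sum_comm]
  refine Finset.sum_congr rfl fun i _ => Finset.sum_congr rfl fun T _ => ?_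
  ring

/-- A function that is `ℂ`-linear in a slot has no part of type `(0,1)` in that slot. -/
theorem partSum_eq_zero {r : ℕ} {S : Finset (Fin r)} {f : (Fin r → V) → ℂ} {j : Fin r}
    (hj : j ∉ S) (hf : ∀ v, f (Function.update v j (Complex.I • v j)) = Complex.I * f v)
    (v : Fin r → V) : partSum S f v = 0 := by
  unfold partSum
  rw [sum_eq_zero_of_toggle j, mul_zero]
  intro T hT
  rw [Finset.prod_insert hT, if_neg hj, twist_insert hT, hf]
  linear_combination (∏ j ∈ T, if j ∈ S then -Complex.I else Complex.I) * f (twist T v) *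
    Complex.I_mul_I

/-- Each vector is the sum of its two parts. In the expansion, a nonempty `T` contributes zero
because moving some `j ∈ T` in or out of `S` flips the sign; `T = ∅` occurs `2^r` times and cancels
the normalization. -/
theorem sum_partSum {r : ℕ} (f : (Fin r → V) → ℂ) (v : Fin r → V) :
    ∑ S, partSum S f v = f v := by
  simp only [partSum]
  rw [← Finset.mul_sum, Finset.sum_comm, Finset.sum_eq_single (∅ : Finset (Fin r))]
  · have : twist ∅ v = v := by ext; simp [twist]
    simp [this]
  · intro T _ hT
    obtain ⟨j, hj⟩ := Finset.nonempty_iff_ne_empty.2 hT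
    refine sum_eq_zero_of_toggle j _ fun S hS => ?_
    rw [← Finset.mul_prod_erase _ _ hj, ← Finset.mul_prod_erase _ _ hj, if_pos (by simp), if_neg hS,
      neg_mul, neg_mul]
    congr 3
    refine Finset.prod_congr rfl fun l hl => ?_
    simp [Finset.ne_of_mem_erase hl]
  · simp

/-- The (1,0)- and (0,1)-parts are eigenvectors of the complex structure, with eigenvalues `i` and
`-i`. Multiplying slot `j` by `i` exchanges the terms with `j ∈ T` and `j ∉ T`. -/
theorem partSum_update {r : ℕ} (S : Finset (Fin r)) {f : (Fin r → V) → ℂ} {j : Fin r}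
    (hf : ∀ v x, f (Function.update v j (-x)) = -f (Function.update v j x))
    (v : Fin r → V) :
    partSum S f (Function.update v j (Complex.I • v j)) =
      (if j ∈ S then Complex.I else -Complex.I) * partSum S f v := by
  unfold partSum
  rw [mul_left_comm]
  congr 1
  rw [Finset.mul_sum, ← Equiv.sum_comp (toggle j) (fun T => _ * (_ * f (twist T v)))]
  refine Finset.sum_congr rfl fun T _ => ?_
  by_cases hT : j ∈ T
  · have e : twist T (Function.update v j (Complex.I • v j)) =
        Function.update (twist (T.erase j) v) j (-v j) := by
      ext l
      by_cases hl : l = j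
      · subst hl; simp [twist, hT, smul_smul]
      · simp [twist, hl]
    have e' : twist (T.erase j) v = Function.update (twist (T.erase j) v) j (v j) := by
      ext l
      by_cases hl : l = j
      · subst hl; simp [twist]
      · simp [hl]
    rw [toggle_of_mem hT, e, hf, ← e', ← Finset.mul_prod_erase _ _ hT]
    split_ifs <;> ring
  · rw [toggle_of_notMem hT, Finset.prod_insert hT, twist_insert hT, twist_update]
    split_ifs
    · linear_combination ((∏ j ∈ T, if j ∈ S then -Complex.I else Complex.I) *
        f (Function.update (twist T v) j (Complex.I • twist T v j))) * Complex.I_mul_I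
    · linear_combination ((∏ j ∈ T, if j ∈ S then -Complex.I else Complex.I) *
        f (Function.update (twist T v) j (Complex.I • twist T v j))) * Complex.I_mul_I

end PartSum

/-! ### Type decomposition and circle weights. -/

section Types

variable {V : Type*} [AddCommGroup V] [Module ℂ V] [TopologicalSpace V]
  [IsTopologicalAddGroup V] [ContinuousSMul ℂ V]

theorem evalParts_eq_partSum {r : ℕ} (S : Finset (Fin r)) (α : V [⋀^Fin r]→L[ℝ] ℂ)
    (v : Fin r → V) : evalParts S α v = partSum S α v := evalParts_apply S α v

theorem typeComponent_apply (a b : ℕ) {r : ℕ} (α : V [⋀^Fin r]→L[ℝ] ℂ) (v : Fin r → V) :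
    typeComponent a b α v =
      ∑ S : Finset (Fin r) with S.card = a ∧ Sᶜ.card = b, partSum S α v := by
  change (∑ S : Finset (Fin r) with S.card = a ∧ Sᶜ.card = b, evalParts S α) v = _
  simp only [sum_apply, evalParts_eq_partSum]

theorem sum_typeComponent {r : ℕ} (α : V [⋀^Fin r]→L[ℝ] ℂ) :
    ∑ a ∈ Finset.range (r + 1), typeComponent a (r - a) α = α := by
  ext v
  rw [ContinuousAlternatingMap.sum_apply]
  simp only [typeComponent_apply]
  rw [← sum_partSum α v,
    ← Finset.sum_fiberwise_of_maps_to (g := Finset.card) (t := Finset.range (r + 1))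
      (fun S _ => by
        have := Finset.card_le_univ S
        rw [Fintype.card_fin] at this
        exact Finset.mem_range.2 (by omega))]
  refine Finset.sum_congr rfl fun a _ => Finset.sum_congr ?_ fun _ _ => rfl
  ext S
  simp only [Finset.mem_filter, Finset.mem_univ, true_and, Finset.card_compl, Fintype.card_fin]
  omega

/-- A multilinear map for which multiplication by `i` in slot `j` acts as `ε j` is multiplied by
`∏ j, (a + b ε j)` if all arguments are multiplied by `a + b i`. -/
theorem map_smul_of_eigen {r : ℕ} (f : ContinuousMultilinearMap ℝ (fun _ : Fin r => V) ℂ)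
    (ε : Fin r → ℂ) (hε : ∀ v j, f (Function.update v j (Complex.I • v j)) = ε j * f v)
    (c : ℂ) (v : Fin r → V) :
    f (fun j => c • v j) = (∏ j, (c.re + c.im * ε j)) * f v := by
  suffices h : ∀ s : Finset (Fin r), f (s.piecewise (fun j => c • v j) v) =
      (∏ j ∈ s, (c.re + c.im * ε j)) * f v by
    simpa using h Finset.univ
  intro s
  induction s using Finset.induction_on with
  | empty => simp
  | insert j s hj ih =>
    set w := s.piecewise (fun j => c • v j) v with hw
    have hwj : w j = v j := by simp [hw, hj]
    have hc : c • v j = c.re • w j + c.im • (Complex.I • w j) := by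
      rw [hwj, ← Complex.coe_smul c.re, ← Complex.coe_smul c.im, smul_smul, ← add_smul,
        Complex.re_add_im]
    rw [Finset.piecewise_insert, ← hw, hc, f.map_update_add, f.map_update_smul, f.map_update_smul,
      hε, Function.update_eq_self, ih, Finset.prod_insert hj]
    simp only [Complex.real_smul]
    ring

theorem evalParts_update {r : ℕ} (S : Finset (Fin r)) (α : V [⋀^Fin r]→L[ℝ] ℂ) (v : Fin r → V)
    (j : Fin r) : evalParts S α (Function.update v j (Complex.I • v j)) =
      (if j ∈ S then Complex.I else -Complex.I) * evalParts S α v := by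
  simp only [evalParts_eq_partSum]
  exact partSum_update S (fun v x => α.map_update_neg v j x) v

/-- Each slot of `S` contributes a factor `c` and each other slot its conjugate. This weight is what
detects the type in top degree. -/
theorem typeComponent_smul (a b : ℕ) {r : ℕ} (α : V [⋀^Fin r]→L[ℝ] ℂ) (c : ℂ) (v : Fin r → V) :
    typeComponent a b α (fun j => c • v j) =
      (c ^ a * (starRingEnd ℂ) c ^ b) * typeComponent a b α v := by
  rw [typeComponent_apply, typeComponent_apply, Finset.mul_sum]
  refine Finset.sum_congr rfl fun S hS => ?_
  obtain ⟨h1, h2⟩ := (Finset.mem_filter.1 hS).2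
  rw [← evalParts_eq_partSum, ← evalParts_eq_partSum,
    map_smul_of_eigen _ _ (fun v j => evalParts_update S α v j)]
  congr 1
  have h (j : Fin r) : ((c.re : ℂ) + c.im * (if j ∈ S then Complex.I else -Complex.I)) =
      if j ∈ S then c else (starRingEnd ℂ) c := by
    split_ifs
    · exact Complex.re_add_im c
    · apply Complex.ext <;> simp
  simp only [h]
  rw [Finset.prod_ite, Finset.prod_const, Finset.prod_const, ← h1, ← h2]
  congr 3
  · ext; simp
  · ext; simp

/-- A form that is `ℂ`-linear in each argument. -/
def IsComplexLinear {r : ℕ} (α : V [⋀^Fin r]→L[ℝ] ℂ) : Prop :=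
  ∀ v j, α (Function.update v j (Complex.I • v j)) = Complex.I * α v

theorem IsSimple.isComplexLinear {k : ℕ} {β : V [⋀^Fin k]→L[ℝ] ℂ} (hβ : IsSimple β) :
    IsComplexLinear β := by
  obtain ⟨ψ, rfl⟩ := hβ
  intro v j
  rw [wedgeOneZero_apply, wedgeOneZero_apply, ← altSum_const_mul]
  refine Finset.sum_congr rfl fun σ _ => ?_
  congr 1
  have h (i : Fin k) : ψ i ((Function.update v j (Complex.I • v j) ∘ σ) i) =
      (if σ i = j then Complex.I else 1) * ψ i (v (σ i)) := by
    by_cases h : σ i = j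
    · simp [← h]
    · simp [h]
  simp only [h, Finset.prod_mul_distrib]
  congr 1
  rw [Finset.prod_eq_single (σ.symm j)]
  · simp
  · intro i _ hi
    rw [if_neg]
    rintro rfl
    simp at hi
  · simp

theorem IsComplexLinear.map_smul {r : ℕ} {β : V [⋀^Fin r]→L[ℝ] ℂ} (hβ : IsComplexLinear β)
    (c : ℂ) (v : Fin r → V) : β (fun j => c • v j) = c ^ r * β v := by
  have := map_smul_of_eigen β.toContinuousMultilinearMap (fun _ => Complex.I) hβ c v
  simpa using this

end Types

/-! ### Forms of top degree. -/

section TopDegree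

/-- Real top forms are multiples of the determinant; the complex-valued case follows from real and
imaginary parts. -/
theorem map_comp_of_finrank {V : Type*} [AddCommGroup V] [Module ℝ V] {m : ℕ}
    (hm : Module.finrank ℝ V = m) (hm0 : m ≠ 0) (τ : V [⋀^Fin m]→ₗ[ℝ] ℂ) (f : V →ₗ[ℝ] V)
    (v : Fin m → V) : τ (f ∘ v) = ((LinearMap.det f : ℝ) : ℂ) * τ v := by
  have : FiniteDimensional ℝ V := FiniteDimensional.of_finrank_pos (by omega)
  let b : Module.Basis (Fin m) ℝ V := Module.finBasisOfFinrankEq ℝ V hm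
  have h (L : ℂ →ₗ[ℝ] ℝ) : L (τ (f ∘ v)) = LinearMap.det f * L (τ v) := by
    have h1 (w : Fin m → V) : L (τ w) = L (τ b) * b.det w := by
      have := (L.compAlternatingMap τ).eq_smul_basis_det b
      simpa using congrArg (fun g => g w) this
    rw [h1, h1 v, Module.Basis.det_comp]
    ring
  apply Complex.ext
  · simpa using h Complex.reLm
  · simpa using h Complex.imLm

variable {V : Type*} [AddCommGroup V] [Module ℂ V] [TopologicalSpace V]
  [IsTopologicalAddGroup V] [ContinuousSMul ℂ V]

theorem det_restrictScalars_complex [FiniteDimensional ℂ V] (A : V →ₗ[ℂ] V) :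
    LinearMap.det (A.restrictScalars ℝ) = Complex.normSq (LinearMap.det A) := by
  rw [LinearMap.det_restrictScalars, Algebra.norm_complex_apply]

theorem top_form_comp {n m : ℕ} (hn : Module.finrank ℂ V = n) (hm : m = 2 * n) (hn0 : n ≠ 0)
    (τ : V [⋀^Fin m]→L[ℝ] ℂ) (A : V →ₗ[ℂ] V) (v : Fin m → V) :
    τ (A ∘ v) = (Complex.normSq (LinearMap.det A) : ℂ) * τ v := by
  have : FiniteDimensional ℂ V := FiniteDimensional.of_finrank_pos (by omega)
  have hr : Module.finrank ℝ V = m := by rw [finrank_real_of_complex, hn, hm]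
  rw [← det_restrictScalars_complex]
  exact map_comp_of_finrank hr (by omega) τ.toAlternatingMap (A.restrictScalars ℝ) v

/-- Multiplication by a unit scalar has real determinant `|c^n|² = 1`, so it fixes every top form; a
form of weight `μ ≠ 1` must then vanish. -/
theorem top_form_eq_zero {n m : ℕ} (hn : Module.finrank ℂ V = n) (hm : m = 2 * n) (hn0 : n ≠ 0)
    (τ : V [⋀^Fin m]→L[ℝ] ℂ) (c μ : ℂ) (hc : ‖c‖ = 1) (hμ : μ ≠ 1)
    (h : ∀ v, τ (fun j => c • v j) = μ * τ v) : τ = 0 := by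
  ext v
  have h1 := top_form_comp hn hm hn0 τ (c • LinearMap.id) v
  have h2 : Complex.normSq (LinearMap.det (c • LinearMap.id : V →ₗ[ℂ] V)) = 1 := by
    rw [LinearMap.det_smul, Complex.normSq_eq_norm_sq]
    simp [hc]
  rw [h2] at h1
  have h3 : τ (fun j => c • v j) = τ v := by simpa [Function.comp_def] using h1
  rw [h v] at h3
  have h4 : (μ - 1) * τ v = 0 := by rw [sub_mul, h3]; ring
  simpa [sub_ne_zero.2 hμ] using h4

theorem wedge_map_smul {r s : ℕ} (α : V [⋀^Fin r]→L[ℝ] ℂ) (β : V [⋀^Fin s]→L[ℝ] ℂ) (c a b : ℂ)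
    (hα : ∀ v, α (fun j => c • v j) = a * α v) (hβ : ∀ v, β (fun j => c • v j) = b * β v)
    (v : Fin (r + s) → V) : wedge α β (fun j => c • v j) = (a * b) * wedge α β v := by
  rw [wedge_apply, wedge_apply, mul_left_comm, ← altSum_const_mul (a * b)]
  congr 1
  refine Finset.sum_congr rfl fun σ _ => ?_
  congr 1
  have h1 := hα ((v ∘ σ) ∘ Fin.castAdd s)
  have h2 := hβ ((v ∘ σ) ∘ Fin.natAdd r)
  simp only [tens]
  calc _ = (a * α ((v ∘ σ) ∘ Fin.castAdd s)) * (b * β ((v ∘ σ) ∘ Fin.natAdd r)) := by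
        rw [← h1, ← h2]; rfl
    _ = _ := by ring

/-- In the top degree only the `(p,p)`-component of a `2p`-form contributes to the wedge product
with `ξ ∧ ξ̄`, if `ξ` is of type `(k,0)`. -/
theorem wedge_typeComponent {n p k : ℕ} (hn : Module.finrank ℂ V = n) (hpk : p + k = n)
    (hn0 : n ≠ 0) (Ψ : V [⋀^Fin (2 * p)]→L[ℝ] ℂ) {ξ : V [⋀^Fin k]→L[ℝ] ℂ}
    (hξ : IsComplexLinear ξ) :
    wedge (wedge (typeComponent p p Ψ) ξ) (conj ξ) = wedge (wedge Ψ ξ) (conj ξ) := by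
  conv_rhs => rw [← sum_typeComponent Ψ]
  rw [← wedgeBilin_apply (∑ a ∈ _, _) ξ, map_sum, LinearMap.sum_apply,
    ← wedgeBilin_apply (∑ a ∈ _, _) (conj ξ), map_sum, LinearMap.sum_apply, Finset.sum_eq_single_of_mem p (Finset.mem_range.2 (by omega))]
  · rw [show 2 * p - p = p by omega]; rfl
  · intro a ha hap
    have ha' : a ≤ 2 * p := by have := Finset.mem_range.1 ha; omega
    have hd : (a : ℂ) - p ≠ 0 := sub_ne_zero.2 (by exact_mod_cast hap)
    -- The total weight of the (a, 2p-a)-component wedged with `ξ` and `ξ̄` is `c^(2(a-p))`; this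
    -- angle makes it `exp(iπ) = -1`.
    let t : ℝ := Real.pi / (2 * (a - p))
    let c : ℂ := Complex.exp (t * Complex.I)
    have hc : ‖c‖ = 1 := Complex.norm_exp_ofReal_mul_I t
    have hcc : c * (starRingEnd ℂ) c = 1 := by
      rw [Complex.mul_conj, Complex.normSq_eq_norm_sq, hc]; simp
    have hμ : (c ^ a * (starRingEnd ℂ) c ^ (2 * p - a) * c ^ k) * (starRingEnd ℂ) c ^ k = -1 := by
      have hconj : (starRingEnd ℂ) c = Complex.exp (-(t * Complex.I)) := by
        simp [c, ← Complex.exp_conj]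
      rw [mul_assoc, ← mul_pow, hcc, one_pow, mul_one, hconj, ← Complex.exp_nat_mul,
        ← Complex.exp_nat_mul, ← Complex.exp_add, ← Complex.exp_pi_mul_I]
      congr 1
      push_cast [t, Nat.cast_sub ha']
      field_simp
      ring
    refine top_form_eq_zero hn (by omega) hn0 _ c (-1) hc (by norm_num) fun v => ?_
    rw [← hμ]
    refine wedge_map_smul _ _ c _ _ (fun v => ?_) (fun v => ?_) v
    · exact wedge_map_smul _ _ c _ _ (fun v => typeComponent_smul a (2 * p - a) Ψ c v)
        (fun v => hξ.map_smul c v) v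
    · rw [conj_apply, hξ.map_smul, map_mul, map_pow, conj_apply]

end TopDegree

/-! ### Volume forms of coframes. -/

section VolForm

variable {V : Type*} [AddCommGroup V] [Module ℂ V] [TopologicalSpace V]
  [IsTopologicalAddGroup V] [ContinuousSMul ℂ V]

theorem altSum_tens_altSum {r s : ℕ} (f : (Fin r → V) → ℂ) (g : (Fin s → V) → ℂ)
    (v : Fin (r + s) → V) : altSum (tens (altSum f) (altSum g)) v =
      (r.factorial : ℂ) * (s.factorial : ℂ) * altSum (tens f g) v := by
  have h1 := altSum_tens_sum_left (fun σ : Equiv.Perm (Fin r) => ((Equiv.Perm.sign σ : ℤ) : ℂ)) id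
    (fun _ => rfl) f (altSum g) v
  have h2 := altSum_tens_sum_right (fun σ : Equiv.Perm (Fin s) => ((Equiv.Perm.sign σ : ℤ) : ℂ)) id
    (fun _ => rfl) f g v
  rw [Fintype.card_perm, Fintype.card_fin] at h1 h2
  rw [mul_assoc, ← h2]
  exact h1

/-- The factorials cancel against the double antisymmetrization, leaving the Leibniz formula for a
determinant. -/
theorem wedge_wedgeOneZero_conj_apply {n : ℕ} (φ : Fin n → (V →L[ℂ] ℂ)) (v w : Fin n → V) :
    wedge (wedgeOneZero φ) (conj (wedgeOneZero φ)) (Fin.append v w) =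
      (Matrix.fromBlocks (Matrix.of fun i j => φ j (v i))
        (Matrix.of fun i j => (starRingEnd ℂ) (φ j (v i))) (Matrix.of fun i j => φ j (w i))
        (Matrix.of fun i j => (starRingEnd ℂ) (φ j (w i)))).det := by
  have h1 : (wedgeOneZero φ : (Fin n → V) → ℂ) = altSum (fun w => ∏ j, φ j (w j)) :=
    funext (wedgeOneZero_apply φ)
  have h2 : (conj (wedgeOneZero φ) : (Fin n → V) → ℂ) =
      altSum (fun w => ∏ j, (starRingEnd ℂ) (φ j (w j))) := by
    funext v
    rw [conj_apply, wedgeOneZero_apply]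
    simp [altSum]
  rw [wedge_apply, h1, h2, altSum_tens_altSum, ← mul_assoc, inv_mul_cancel₀, one_mul,
    ← Matrix.det_reindex_self finSumFinEquiv, Matrix.det_apply']
  · have hl (i : Fin n) : finSumFinEquiv.symm (Fin.castAdd n i) = Sum.inl i := by simp
    have hr (i : Fin n) : finSumFinEquiv.symm (Fin.natAdd n i) = Sum.inr i :=
      finSumFinEquiv_symm_apply_natAdd i
    refine Finset.sum_congr rfl fun σ _ => congrArg (_ * ·) ?_
    rw [Fin.prod_univ_add]
    unfold tens
    refine congrArg₂ (· * ·) (Finset.prod_congr rfl fun j _ => ?_)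
      (Finset.prod_congr rfl fun j _ => ?_)
    · simp only [Function.comp_apply, Matrix.reindex_apply, Matrix.submatrix_apply, hl]
      refine Fin.addCases (fun i => ?_) (fun i => ?_) (σ (Fin.castAdd n j))
      · rw [hl, Fin.append_left, Matrix.fromBlocks_apply₁₁, Matrix.of_apply]
      · rw [hr, Fin.append_right, Matrix.fromBlocks_apply₂₁, Matrix.of_apply]
    · simp only [Function.comp_apply, Matrix.reindex_apply, Matrix.submatrix_apply, hr]
      refine Fin.addCases (fun i => ?_) (fun i => ?_) (σ (Fin.natAdd n j))
      · rw [hl, Fin.append_left, Matrix.fromBlocks_apply₁₂, Matrix.of_apply]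
      · rw [hr, Fin.append_right, Matrix.fromBlocks_apply₂₂, Matrix.of_apply]
  · have := n.factorial_ne_zero
    simp [this]

theorem sigma_ne_zero (n : ℕ) : sigma n ≠ 0 := by
  simp [sigma]

theorem exists_dual_vectors [FiniteDimensional ℂ V] [T2Space V] {n : ℕ}
    (φ : Module.Basis (Fin n) ℂ (V →L[ℂ] ℂ)) :
    ∃ e : Fin n → V, ∀ i j, φ j (e i) = if i = j then 1 else 0 := by
  let φ' : Module.Basis (Fin n) ℂ (Module.Dual ℂ V) :=
    φ.map (LinearMap.toContinuousLinearMap (𝕜 := ℂ) (E := V) (F' := ℂ)).symm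
  refine ⟨fun i => (Module.evalEquiv ℂ V).symm (φ'.dualBasis i), fun i j => ?_⟩
  have h : φ' j ((Module.evalEquiv ℂ V).symm (φ'.dualBasis i)) = φ'.dualBasis i (φ' j) := by
    rw [Module.apply_evalEquiv_symm_apply]
  have h' (v : V) : φ j v = φ' j v := by simp [φ']
  rw [h', h, Module.Basis.dualBasis_apply_self]
  simp [eq_comm]

/-- The volume form of a coframe does not vanish. -/
theorem volForm_ne_zero [FiniteDimensional ℂ V] [T2Space V] {n : ℕ}
    (φ : Module.Basis (Fin n) ℂ (V →L[ℂ] ℂ)) : volForm (fun i => φ i) ≠ 0 := by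
  obtain ⟨e, he⟩ := exists_dual_vectors φ
  intro h
  -- On the real basis `e, i e` the block matrix has rows `(1, 1)` and `(i, -i)`, with determinant
  -- `(-2i)^n`.
  have h1 : sigma n * wedge (wedgeOneZero φ) (conj (wedgeOneZero φ))
      (Fin.append e (fun i => Complex.I • e i)) = 0 :=
    congrArg (fun τ => τ (Fin.append e (fun i => Complex.I • e i))) h
  rw [wedge_wedgeOneZero_conj_apply, mul_eq_zero, or_iff_right (sigma_ne_zero n)] at h1
  have e1 : (Matrix.of fun i j => φ j (e i)) = (1 : Matrix (Fin n) (Fin n) ℂ) := by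
    ext i j; simp [he, Matrix.one_apply]
  have e2 : (Matrix.of fun i j => (starRingEnd ℂ) (φ j (e i))) =
      (1 : Matrix (Fin n) (Fin n) ℂ) := by
    ext i j; simp [he, Matrix.one_apply, apply_ite]
  have e3 : (Matrix.of fun i j => φ j (Complex.I • e i)) =
      Complex.I • (1 : Matrix (Fin n) (Fin n) ℂ) := by
    ext i j; simp [he, Matrix.one_apply]
  have e4 : (Matrix.of fun i j => (starRingEnd ℂ) (φ j (Complex.I • e i))) =
      (-Complex.I) • (1 : Matrix (Fin n) (Fin n) ℂ) := by
    ext i j; simp [he, Matrix.one_apply, apply_ite]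
  rw [e1, e2, e3, e4, Matrix.det_fromBlocks_one₁₁, mul_one, ← sub_smul, Matrix.det_smul] at h1
  have h2 : -Complex.I - Complex.I ≠ 0 := by
    rw [← neg_add', ← two_mul]; simp
  simp [h2] at h1

theorem wedgeOneZero_comp {k : ℕ} (ψ : Fin k → (V →L[ℂ] ℂ)) (A : V →L[ℂ] V) (v : Fin k → V) :
    wedgeOneZero (fun i => (ψ i).comp A) v = wedgeOneZero ψ (A ∘ v) := by
  rw [wedgeOneZero_apply, wedgeOneZero_apply]; rfl

theorem volForm_comp {n : ℕ} (ψ : Fin n → (V →L[ℂ] ℂ)) (A : V →L[ℂ] V) (v : Fin (n + n) → V) :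
    volForm (fun i => (ψ i).comp A) v = volForm ψ (A ∘ v) := by
  have h : wedgeOneZero (fun i => (ψ i).comp A) =
      (wedgeOneZero ψ).compContinuousLinearMap (A.restrictScalars ℝ) := by
    ext v; exact wedgeOneZero_comp ψ A v
  unfold volForm
  rw [h, ← conj_comp, ← wedge_comp]
  rfl

/-- The volume forms of two coframes differ by a positive factor. -/
theorem volForm_eq_pos_mul [FiniteDimensional ℂ V] [T2Space V] {n : ℕ} (hn0 : n ≠ 0)
    (hn : Module.finrank ℂ V = n) (φ φ₀ : Module.Basis (Fin n) ℂ (V →L[ℂ] ℂ)) :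
    ∃ a : ℝ, 0 < a ∧ ∀ v, volForm (fun i => φ i) v = a * volForm (fun i => φ₀ i) v := by
  obtain ⟨A, hA⟩ : ∃ A : V →L[ℂ] V, ∀ i, φ i = (φ₀ i).comp A := by
    obtain ⟨e, he⟩ := exists_dual_vectors φ₀
    -- `A = ∑ φ_j ⊗ e_j`, with `e` dual to `φ₀`, pulls `φ₀` back to `φ`.
    refine ⟨∑ j, (φ j).smulRight (e j), fun i => ?_⟩
    ext v
    simp [he]
  have h (v : Fin (n + n) → V) : volForm (fun i => φ i) v =
      (Complex.normSq (LinearMap.det (A : V →ₗ[ℂ] V)) : ℂ) * volForm (fun i => φ₀ i) v := by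
    simp only [hA]
    rw [volForm_comp, ← top_form_comp hn (by omega) hn0]
    rfl
  -- The factor is `|det A|²`; were it zero, the volume form of `φ` would vanish.
  refine ⟨_, lt_of_le_of_ne (Complex.normSq_nonneg _) fun h0 => ?_, h⟩
  apply volForm_ne_zero φ
  ext v
  rw [h, ← h0]
  simp

end VolForm

/-! ### Leibniz rule and closedness in a vector space. -/

section Leibniz

variable {E : Type*} [NormedAddCommGroup E] [NormedSpace ℂ E]

/-- The signed sum of `α ⊗ β`, where the `r + 1`-form `α` is the alternatization of `A`. -/
theorem altSum_alternatize_tens {r s : ℕ} (A : E →L[ℝ] E [⋀^Fin r]→L[ℝ] ℂ)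
    (β : (Fin s → E) → ℂ) (v : Fin (r + 1 + s) → E) :
    altSum (tens (ContinuousAlternatingMap.alternatizeUncurryFin A) β) v =
      (r + 1) * altSum (tens (fun w => A (w 0) (Fin.tail w)) β) v := by
  have h := altSum_tens_sum_left (fun i : Fin (r + 1) => (-1 : ℂ) ^ (i : ℕ))
    (fun i => i.cycleRange.symm) (fun i => by simp [Fin.sign_cycleRange])
    (fun w => A (w 0) (Fin.tail w)) β v
  rw [Fintype.card_fin] at h
  push_cast at h
  rw [← h]
  refine congrArg (fun f => altSum (tens f β) v) (funext fun w => ?_)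
  rw [ContinuousAlternatingMap.alternatizeUncurryFin_apply]
  refine Finset.sum_congr rfl fun i _ => ?_
  rw [← Fin.cons_removeNth_eq_comp_cycleRange_symm, Fin.cons_zero, Fin.tail_cons, zsmul_eq_mul]
  push_cast
  rfl

theorem altSum_tens_alternatize {r s : ℕ} (α : (Fin r → E) → ℂ)
    (B : E →L[ℝ] E [⋀^Fin s]→L[ℝ] ℂ) (v : Fin (r + (s + 1)) → E) :
    altSum (tens α (ContinuousAlternatingMap.alternatizeUncurryFin B)) v =
      (s + 1) * altSum (tens α (fun w => B (w 0) (Fin.tail w))) v := by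
  have h := altSum_tens_sum_right (fun i : Fin (s + 1) => (-1 : ℂ) ^ (i : ℕ))
    (fun i => i.cycleRange.symm) (fun i => by simp [Fin.sign_cycleRange])
    α (fun w => B (w 0) (Fin.tail w)) v
  rw [Fintype.card_fin] at h
  push_cast at h
  rw [← h]
  refine congrArg (fun f => altSum (tens α f) v) (funext fun w => ?_)
  rw [ContinuousAlternatingMap.alternatizeUncurryFin_apply]
  refine Finset.sum_congr rfl fun i _ => ?_
  rw [← Fin.cons_removeNth_eq_comp_cycleRange_symm, Fin.cons_zero, Fin.tail_cons, zsmul_eq_mul]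
  push_cast
  rfl

theorem sum_altSum_tens_left {r s : ℕ} (A : E →L[ℝ] E [⋀^Fin r]→L[ℝ] ℂ)
    (β : (Fin s → E) → ℂ) (v : Fin (r + s + 1) → E) :
    ∑ i : Fin (r + s + 1), (-1) ^ (i : ℕ) * altSum (tens (A (v i)) β) (i.removeNth v) =
      altSum (tens (fun w : Fin (r + 1) → E => A (w 0) (Fin.tail w)) β)
        (v ∘ Fin.cast (by omega)) := by
  rw [← altSum_cast, altSum_succ]
  refine Finset.sum_congr rfl fun i _ => congrArg (_ * ·) ?_
  refine congrArg (fun T => altSum T _) (funext fun w => ?_)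
  unfold tens
  refine congrArg₂ (· * ·) ?_ (congrArg β (funext fun j => ?_))
  · refine congrArg₂ (fun x u => A x u) rfl (funext fun j => ?_)
    change w _ = (Fin.cons (v i) w : Fin (r + s + 1) → E) ((Fin.castAdd s j).succ)
    rw [Fin.cons_succ]
  · have : Fin.cast (by omega : r + 1 + s = r + s + 1) (Fin.natAdd (r + 1) j) =
        (Fin.natAdd r j).succ := by ext; simp; omega
    simp only [Function.comp_apply, this, Fin.cons_succ]

/-- The differentiating vector must pass the `r` arguments of `α`, which costs the sign of a cycle.
Its value is left unspecified because the term is used only when it vanishes. -/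
theorem sum_altSum_tens_right {r s : ℕ} (α : (Fin r → E) → ℂ)
    (B : E →L[ℝ] E [⋀^Fin s]→L[ℝ] ℂ) (v : Fin (r + s + 1) → E) :
    ∃ ε : ℂ, ∑ i : Fin (r + s + 1), (-1) ^ (i : ℕ) * altSum (tens α (B (v i))) (i.removeNth v) =
      ε * altSum (tens α (fun w : Fin (s + 1) → E => B (w 0) (Fin.tail w))) v := by
  let T : (Fin (r + s + 1) → E) → ℂ := fun w => tens α (B (w 0)) (Fin.tail w)
  have h1 : ∑ i : Fin (r + s + 1), (-1) ^ (i : ℕ) * altSum (tens α (B (v i))) (i.removeNth v) =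
      altSum T v := by
    rw [altSum_succ]
    simp only [T, Fin.cons_zero, Fin.tail_cons]
  let q : Fin (r + s + 1) := Fin.natAdd r (0 : Fin (s + 1))
  have h2 : (fun w => T (w ∘ q.cycleRange.symm)) =
      tens α (fun w : Fin (s + 1) → E => B (w 0) (Fin.tail w)) := by
    funext w
    rw [← Fin.cons_removeNth_eq_comp_cycleRange_symm]
    simp only [T, Fin.cons_zero, Fin.tail_cons]
    unfold tens
    refine congrArg₂ (· * ·) (congrArg α (funext fun j => ?_)) ?_
    · refine congrArg w ?_
      rw [Fin.succAbove_of_castSucc_lt]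
      · rfl
      · simp [Fin.lt_def, q]
    · refine congrArg (B (w q)) (funext fun j => congrArg w ?_)
      rw [Fin.succAbove_of_le_castSucc]
      · rfl
      · simp [Fin.le_def, q]
  refine ⟨((Equiv.Perm.sign q.cycleRange.symm : ℤ) : ℂ), ?_⟩
  rw [h1, ← h2, altSum_comp_perm T, ← mul_assoc, sign_mul_sign_cast, one_mul]

/-- Makes the algebraic operations on forms continuous, hence smooth, without norm estimates. -/
instance finiteDimensional_forms [FiniteDimensional ℂ E] (r : ℕ) :
    FiniteDimensional ℝ (E [⋀^Fin r]→L[ℝ] ℂ) := by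
  have : FiniteDimensional ℝ E := FiniteDimensional.complexToReal E
  let L : (E [⋀^Fin r]→L[ℝ] ℂ) →ₗ[ℝ] MultilinearMap ℝ (fun _ : Fin r => E) ℂ :=
    { toFun := fun α => α.toMultilinearMap
      map_add' := fun _ _ => rfl
      map_smul' := fun _ _ => rfl }
  refine FiniteDimensional.of_injective L fun α β h => ?_
  ext v
  exact congrArg (fun f : MultilinearMap ℝ (fun _ : Fin r => E) ℂ => f v) h

variable [FiniteDimensional ℂ E]

variable (E) in
/-- The wedge product as a continuous bilinear map. -/
def wedgeCLM (r s : ℕ) :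
    (E [⋀^Fin r]→L[ℝ] ℂ) →L[ℝ] (E [⋀^Fin s]→L[ℝ] ℂ) →L[ℝ] E [⋀^Fin (r + s)]→L[ℝ] ℂ :=
  (wedgeBilin r s).toContinuousBilinearMap

variable (E) in
/-- Conjugation of forms as a continuous linear map. -/
def conjFormCLM (r : ℕ) : (E [⋀^Fin r]→L[ℝ] ℂ) →L[ℝ] E [⋀^Fin r]→L[ℝ] ℂ :=
  LinearMap.toContinuousLinearMap
    { toFun := conj
      map_add' := fun α β => by ext v; simp
      map_smul' := fun c α => by ext v; simp }

@[simp]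
theorem conjFormCLM_apply {r : ℕ} (α : E [⋀^Fin r]→L[ℝ] ℂ) : conjFormCLM E r α = conj α := rfl

/-- Evaluation of forms at fixed vectors as a continuous linear map. -/
def evalFormCLM {r : ℕ} (v : Fin r → E) : (E [⋀^Fin r]→L[ℝ] ℂ) →L[ℝ] ℂ :=
  LinearMap.toContinuousLinearMap
    { toFun := fun α => α v
      map_add' := fun _ _ => rfl
      map_smul' := fun _ _ => rfl }

/-- The Leibniz rule for the wedge product with a closed form. -/
theorem extDeriv_wedge_of_closed {r s : ℕ} {α : E → E [⋀^Fin r]→L[ℝ] ℂ}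
    {β : E → E [⋀^Fin s]→L[ℝ] ℂ} {y : E} (hα : DifferentiableAt ℝ α y)
    (hβ : DifferentiableAt ℝ β y) (hd : extDeriv β y = 0) (v : Fin (r + s + 1) → E) :
    extDeriv (fun z => wedge (α z) (β z)) y v =
      wedge (extDeriv α y) (β y) (v ∘ Fin.cast (by omega)) := by
  have hf : fderiv ℝ (fun z => wedge (α z) (β z)) y =
      (wedgeCLM E r s).precompR E (α y) (fderiv ℝ β y) +
        (wedgeCLM E r s).precompL E (fderiv ℝ α y) (β y) :=
    ((wedgeCLM E r s).hasFDerivAt_of_bilinear hα.hasFDerivAt hβ.hasFDerivAt).fderiv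
  have hw (w : E) : fderiv ℝ (fun z => wedge (α z) (β z)) y w =
      wedge (α y) (fderiv ℝ β y w) + wedge (fderiv ℝ α y w) (β y) := by
    rw [hf]; rfl
  -- The terms differentiating `β` add up to a multiple of `α ∧ dβ`, which is zero.
  obtain ⟨ε, hε⟩ := sum_altSum_tens_right (α y) (fderiv ℝ β y) v
  have h0 : altSum (tens (α y) (extDeriv β y)) v = 0 := by
    rw [hd]
    simp [altSum, tens]
  have hB := altSum_tens_alternatize (α y) (fderiv ℝ β y) v
  rw [extDeriv] at h0
  rw [h0, zero_eq_mul, or_iff_right (by exact_mod_cast s.succ_ne_zero)] at hB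
  rw [hB, mul_zero] at hε
  rw [extDeriv, ContinuousAlternatingMap.alternatizeUncurryFin_apply, wedge_apply, extDeriv,
    altSum_alternatize_tens, ← sum_altSum_tens_left]
  simp only [hw, ContinuousAlternatingMap.add_apply, wedge_apply]
  have hr : (r : ℂ) + 1 ≠ 0 := by exact_mod_cast r.succ_ne_zero
  have hr' : (r.factorial : ℂ) ≠ 0 := by exact_mod_cast r.factorial_ne_zero
  have hs' : (s.factorial : ℂ) ≠ 0 := by exact_mod_cast s.factorial_ne_zero
  -- The factor `r + 1` from alternating `Dα` cancels against `(r + 1)!` in the normalization.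
  rw [Nat.factorial_succ]
  push_cast
  have hsplit : ∀ a b c : Fin (r + s + 1) → ℂ, ∀ k : ℂ,
      ∑ i, a i * (k * b i + k * c i) = k * ∑ i, a i * b i + k * ∑ i, a i * c i := by
    intro a b c k
    rw [Finset.mul_sum, Finset.mul_sum, ← Finset.sum_add_distrib]
    exact Finset.sum_congr rfl fun i _ => by ring
  simp only [zsmul_eq_mul]
  push_cast
  rw [hsplit, hε]
  field_simp
  ring

theorem extDeriv_conj {r : ℕ} {α : E → E [⋀^Fin r]→L[ℝ] ℂ} {y : E}
    (hα : DifferentiableAt ℝ α y) : extDeriv (fun z => conj (α z)) y = conj (extDeriv α y) := by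
  have hf : fderiv ℝ (fun z => conj (α z)) y = (conjFormCLM E r).comp (fderiv ℝ α y) :=
    ((conjFormCLM E r).hasFDerivAt.comp y hα.hasFDerivAt).fderiv
  ext v
  rw [conj_apply, extDeriv, extDeriv, hf, ContinuousAlternatingMap.alternatizeUncurryFin_apply,
    ContinuousAlternatingMap.alternatizeUncurryFin_apply, map_sum]
  refine Finset.sum_congr rfl fun i _ => ?_
  simp

/-- A `(k,0)`-form is closed at a point if the components of type `(k+1,0)` and `(k,1)` of (a
pullback of) its exterior derivative vanish. -/
theorem comp_extDeriv_eq_zero {W : Type*} [AddCommGroup W] [Module ℂ W] [TopologicalSpace W]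
    [IsTopologicalAddGroup W] [ContinuousSMul ℂ W] {k : ℕ} {α : E → E [⋀^Fin k]→L[ℝ] ℂ} {y : E}
    (hα : DifferentiableAt ℝ α y) (hlin : ∀ᶠ z in 𝓝 y, IsComplexLinear (α z)) (D : W →L[ℂ] E)
    (τ : W [⋀^Fin (k + 1)]→L[ℝ] ℂ) (hτ : ∀ v, τ v = extDeriv α y (D ∘ v))
    (h1 : typeComponent (k + 1) 0 τ = 0) (h2 : typeComponent k 1 τ = 0) : τ = 0 := by
  rw [← sum_typeComponent τ]
  refine Finset.sum_eq_zero fun a ha => ?_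
  have ha' : a ≤ k + 1 := by have := Finset.mem_range.1 ha; omega
  obtain rfl | rfl | hak : a = k + 1 ∨ a = k ∨ a < k := by omega
  · simpa using h1
  · simpa using h2
  ext v
  rw [typeComponent_apply]
  refine Finset.sum_eq_zero fun S hS => ?_
  have hS2 : 1 < Sᶜ.card := by have := (Finset.mem_filter.1 hS).2.2; omega
  have e1 : (τ : (Fin (k + 1) → W) → ℂ) = fun w => (fun u => ∑ i : Fin (k + 1),
      (-1 : ℂ) ^ (i : ℕ) * fderiv ℝ α y (u i) (i.removeNth u)) (D ∘ w) := by
    funext w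
    rw [hτ, extDeriv, ContinuousAlternatingMap.alternatizeUncurryFin_apply]
    simp
  rw [e1]
  have := partSum_comp S (fun u : Fin (k + 1) → E => ∑ i : Fin (k + 1),
      (-1 : ℂ) ^ (i : ℕ) * fderiv ℝ α y (u i) (i.removeNth u)) (D : W →ₗ[ℂ] E) v
  refine this.trans ?_
  rw [partSum_sum]
  refine Finset.sum_eq_zero fun i _ => ?_
  -- At least two slots carry (0,1)-parts and only slot `i` holds the direction of differentiation.
  -- Some other such slot `j` is an argument of the form itself, in which the derivative stays
  -- `ℂ`-linear.
  obtain ⟨j, hj, hji⟩ := Finset.exists_mem_ne hS2 i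
  rw [partSum_eq_zero (j := j) (by simpa using hj), mul_zero]
  intro u
  obtain ⟨l, rfl⟩ := Fin.exists_succAbove_eq hji
  rw [Function.update_of_ne (Fin.succAbove_ne i l).symm, Fin.removeNth_update_succAbove]
  have e2 : (fun z => α z (Function.update (i.removeNth u) l (Complex.I • u (i.succAbove l))))
      =ᶠ[𝓝 y] fun z => Complex.I * α z (i.removeNth u) := by
    filter_upwards [hlin] with z hz
    exact hz (i.removeNth u) l
  have hev (w : Fin k → E) : DifferentiableAt ℝ (fun z => α z w) y := by fun_prop
  have e3 (w : Fin k → E) (x : E) : fderiv ℝ α y x w = fderiv ℝ (fun z => α z w) y x := by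
    rw [fderiv_continuousAlternatingMap_apply_const_apply hα]
  rw [e3, e3, e2.fderiv_eq, fderiv_const_mul (hev _)]
  simp

end Leibniz

/-! ### Stokes' theorem in a vector space. -/

section LocalStokes

open MeasureTheory

variable {E : Type*} [NormedAddCommGroup E] [NormedSpace ℂ E] [FiniteDimensional ℂ E]
  [MeasurableSpace E] [BorelSpace E] (μ : Measure E) [μ.IsAddHaarMeasure]

theorem integral_fderiv_apply_eq_zero {g : E → ℂ} (hg : ContDiff ℝ 1 g) (hc : HasCompactSupport g)
    (w : E) : ∫ y, fderiv ℝ g y w ∂μ = 0 := by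
  have : FiniteDimensional ℝ E := FiniteDimensional.complexToReal E
  have hg' : Integrable (fun y => fderiv ℝ g y w) μ :=
    ((hg.continuous_fderiv one_ne_zero).clm_apply continuous_const).integrable_of_hasCompactSupport
      (hc.fderiv_apply ℝ w)
  -- Integration by parts against the constant 1.
  have := integral_mul_fderiv_eq_neg_fderiv_mul_of_integrable (μ := μ) (f := fun _ : E => (1 : ℂ))
    (g := g) (v := w) (by simp) (by simpa using hg')
    (by simpa using hg.continuous.integrable_of_hasCompactSupport hc) (by fun_prop)
    (fun x _ => (hg.differentiable one_ne_zero) x)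
  simpa using this

/-- Stokes' theorem for compactly supported forms on a vector space. -/
theorem integral_extDeriv_eq_zero {N : ℕ} {θ : E → E [⋀^Fin N]→L[ℝ] ℂ} (hθ : ContDiff ℝ 1 θ)
    (hc : HasCompactSupport θ) (v : Fin (N + 1) → E) : ∫ y, extDeriv θ y v ∂μ = 0 := by
  have : FiniteDimensional ℝ E := FiniteDimensional.complexToReal E
  have hg (w : Fin N → E) : ContDiff ℝ 1 (fun y => θ y w) :=
    (evalFormCLM w).contDiff.comp hθ
  have hgc (w : Fin N → E) : HasCompactSupport (fun y => θ y w) :=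
    hc.comp_left (g := fun τ : E [⋀^Fin N]→L[ℝ] ℂ => τ w) rfl
  simp only [extDeriv_apply ((hθ.differentiable one_ne_zero) _)]
  rw [integral_finsetSum]
  · refine Finset.sum_eq_zero fun i _ => ?_
    simp only [zsmul_eq_mul]
    rw [integral_const_mul, integral_fderiv_apply_eq_zero μ (hg _) (hgc _), mul_zero]
  · intro i _
    simp only [zsmul_eq_mul]
    refine Integrable.const_mul ?_ _
    exact (((hg _).continuous_fderiv one_ne_zero).clm_apply
      continuous_const).integrable_of_hasCompactSupport ((hgc _).fderiv_apply ℝ _)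

end LocalStokes

/-! ### Local expressions, change of chart and cutoffs. -/

section Charts

variable {E : Type*} [NormedAddCommGroup E] [NormedSpace ℂ E]
  {M : Type*} [TopologicalSpace M] [ChartedSpace E M]

/-- The derivative of an inverse chart. -/
def symmDeriv (e : OpenPartialHomeomorph M E) (y : E) : E →L[ℂ] E :=
  mfderiv 𝓘(ℂ, E) 𝓘(ℂ, E) e.symm y

/-- The value of a form at a point, with the tangent space identified with the model space. -/
def formAt {r : ℕ} (α : Form E M r) (x : M) : E [⋀^Fin r]→L[ℝ] ℂ := α x

theorem chartForm_apply {r : ℕ} (e : OpenPartialHomeomorph M E) (α : Form E M r) (y : E)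
    (v : Fin r → E) : chartForm e α y v = formAt α (e.symm y) (symmDeriv e y ∘ v) := rfl

theorem chartForm_eq_zero {r : ℕ} (e : OpenPartialHomeomorph M E) (α : Form E M r) {y : E}
    (h : formAt α (e.symm y) = 0) : chartForm e α y = 0 := by
  ext v
  rw [chartForm_apply, h]
  rfl

variable [IsManifold 𝓘(ℂ, E) ω M]

theorem contDiffAt_transition {e e' : OpenPartialHomeomorph M E} (he : e ∈ atlas E M)
    (he' : e' ∈ atlas E M) {y : E} (hy : y ∈ e.target) (hy' : e.symm y ∈ e'.source) :
    ContDiffAt ℂ ω (fun z => e' (e.symm z)) y := by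
  have h1 : ContMDiffAt 𝓘(ℂ, E) 𝓘(ℂ, E) ω e.symm y :=
    contMDiffAt_symm_of_mem_maximalAtlas (IsManifold.subset_maximalAtlas he) hy
  have h2 : ContMDiffAt 𝓘(ℂ, E) 𝓘(ℂ, E) ω e' (e.symm y) :=
    contMDiffAt_of_mem_maximalAtlas (IsManifold.subset_maximalAtlas he') hy'
  exact (h2.comp y h1).contDiffAt

theorem fderiv_real_transition {e e' : OpenPartialHomeomorph M E} (he : e ∈ atlas E M)
    (he' : e' ∈ atlas E M) {y : E} (hy : y ∈ e.target) (hy' : e.symm y ∈ e'.source) :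
    fderiv ℝ (fun z => e' (e.symm z)) y =
      (fderiv ℂ (fun z => e' (e.symm z)) y).restrictScalars ℝ :=
  ((contDiffAt_transition he he' hy hy').differentiableAt (by simp)).fderiv_restrictScalars ℝ

theorem mfderiv_comp_symmDeriv {e e' : OpenPartialHomeomorph M E} (he : e ∈ atlas E M)
    (he' : e' ∈ atlas E M) {y : E} (hy : y ∈ e.target) (hy' : e.symm y ∈ e'.source) (w : E) :
    mfderiv 𝓘(ℂ, E) 𝓘(ℂ, E) e' (e.symm y) (symmDeriv e y w) =
      fderiv ℂ (fun z => e' (e.symm z)) y w := by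
  have : IsManifold 𝓘(ℂ, E) 1 M := IsManifold.of_le (n := ω) le_top
  have h := mfderiv_comp y (mdifferentiableAt_atlas (I := 𝓘(ℂ, E)) he' hy')
    (mdifferentiableAt_atlas_symm (I := 𝓘(ℂ, E)) he hy)
  rw [mfderiv_eq_fderiv] at h
  exact (congrArg (fun L : E →L[ℂ] E => L w) h).symm

theorem symmDeriv_eq {e e' : OpenPartialHomeomorph M E} (he : e ∈ atlas E M)
    (he' : e' ∈ atlas E M) {y : E} (hy : y ∈ e.target) (hy' : e.symm y ∈ e'.source) (w : E) :
    symmDeriv e y w = symmDeriv e' (e' (e.symm y)) (fderiv ℂ (fun z => e' (e.symm z)) y w) := by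
  have : IsManifold 𝓘(ℂ, E) 1 M := IsManifold.of_le (n := ω) le_top
  have h1 := mfderiv_comp y (mdifferentiableAt_atlas_symm (I := 𝓘(ℂ, E)) he' (e'.map_source hy'))
    ((mdifferentiableAt_atlas (I := 𝓘(ℂ, E)) he' hy').comp y
      (mdifferentiableAt_atlas_symm (I := 𝓘(ℂ, E)) he hy))
  have h2 : (e'.symm ∘ (e' ∘ e.symm) : E → M) =ᶠ[𝓝 y] e.symm := by
    filter_upwards [(e.symm.continuousAt hy).preimage_mem_nhds (e'.open_source.mem_nhds hy')]
      with z hz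
    exact e'.left_inv hz
  have h3 := h2.mfderiv_eq (I := 𝓘(ℂ, E)) (I' := 𝓘(ℂ, E))
  have h4 : symmDeriv e y = (symmDeriv e' (e' (e.symm y))).comp
      (fderiv ℂ (fun z => e' (e.symm z)) y) := by
    rw [← mfderiv_eq_fderiv]
    exact h3.symm.trans h1
  exact congrArg (fun L : E →L[ℂ] E => L w) h4

theorem chartForm_transition {r : ℕ} {e e' : OpenPartialHomeomorph M E} (he : e ∈ atlas E M)
    (he' : e' ∈ atlas E M) {y : E} (hy : y ∈ e.target) (hy' : e.symm y ∈ e'.source)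
    (α : Form E M r) (v : Fin r → E) :
    chartForm e α y v =
      chartForm e' α (e' (e.symm y)) (fderiv ℂ (fun z => e' (e.symm z)) y ∘ v) := by
  have hv : symmDeriv e y ∘ v = symmDeriv e' (e' (e.symm y)) ∘
      (fderiv ℂ (fun z => e' (e.symm z)) y ∘ v) :=
    funext fun i => symmDeriv_eq he he' hy hy' (v i)
  rw [chartForm_apply, chartForm_apply, hv, e'.left_inv hy']

/-- In every chart, `d` is the exterior derivative of the local expression. -/
theorem chartForm_d {r : ℕ} {e : OpenPartialHomeomorph M E} (he : e ∈ atlas E M)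
    {α : Form E M r} (hα : IsSmooth α) {y : E} (hy : y ∈ e.target) :
    chartForm e (d α) y = extDeriv (chartForm e α) y := by
  set e' := chartAt E (e.symm y) with he'_def
  have he' : e' ∈ atlas E M := chart_mem_atlas E _
  have hy' : e.symm y ∈ e'.source := mem_chart_source E _
  -- `d` is defined at `e.symm y` through the preferred chart `e'`. Near `y` the local expression in
  -- `e` is the pullback of the one in `e'` by the transition map, and `extDeriv` commutes with
  -- pullback.
  have h1 : chartForm e α =ᶠ[𝓝 y] fun z =>
      (chartForm e' α (e' (e.symm z))).compContinuousLinearMap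
        (fderiv ℝ (fun z => e' (e.symm z)) z) := by
    filter_upwards [e.open_target.mem_nhds hy,
      (e.symm.continuousAt hy).preimage_mem_nhds (e'.open_source.mem_nhds hy')] with z hz hz'
    ext v
    rw [chartForm_transition he he' hz hz', fderiv_real_transition he he' hz hz']
    rfl
  have hdiff : DifferentiableAt ℝ (chartForm e' α) (e' (e.symm y)) :=
    ((hα e' he').contDiffAt (e'.open_target.mem_nhds (e'.map_source hy'))).differentiableAt
      (by simp)
  have h2 : ContDiffAt ℝ ω (fun z => e' (e.symm z)) y :=
    (contDiffAt_transition he he' hy hy').restrict_scalars ℝ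
  rw [h1.extDeriv_eq, extDeriv_pullback (f := fun z => e' (e.symm z)) (x := y) hdiff h2 le_top, fderiv_real_transition he he' hy hy']
  ext v
  rw [chartForm_apply]
  refine congrArg (extDeriv (chartForm e' α) (e' (e.symm y))) (funext fun i => ?_)
  exact mfderiv_comp_symmDeriv he he' hy hy' (v i)

theorem continuousOn_chartForm_d {r : ℕ} {e : OpenPartialHomeomorph M E} (he : e ∈ atlas E M)
    {α : Form E M r} (hα : IsSmooth α) : ContinuousOn (chartForm e (d α)) e.target := by
  have h : ContinuousOn (fderiv ℝ (chartForm e α)) e.target :=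
    (hα e he).continuousOn_fderiv_of_isOpen e.open_target (by simp)
  refine ((ContinuousAlternatingMap.alternatizeUncurryFinCLM ℝ E ℂ).continuous.comp_continuousOn
    h).congr fun y hy => ?_
  exact chartForm_d he hα hy

/-- Holomorphic transition maps are real smooth; the partition of unity lives on this real
structure. -/
theorem isManifold_real : IsManifold 𝓘(ℝ, E) ∞ M := by
  refine isManifold_of_contDiffOn 𝓘(ℝ, E) ∞ M fun e e' he he' => ?_
  intro y hy
  have hy1 : y ∈ (e.symm.trans e').source := by simpa using hy
  rw [OpenPartialHomeomorph.trans_source] at hy1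
  exact (((contDiffAt_transition he he' hy1.1 hy1.2).restrict_scalars ℝ).of_le
    le_top).contDiffWithinAt

theorem contDiffOn_comp_symm {ρ : M → ℝ} (hρ : ContMDiff 𝓘(ℝ, E) 𝓘(ℝ, ℝ) ∞ ρ)
    {e : OpenPartialHomeomorph M E} (he : e ∈ atlas E M) :
    ContDiffOn ℝ ∞ (fun y => ρ (e.symm y)) e.target := by
  have : IsManifold 𝓘(ℝ, E) ∞ M := isManifold_real
  have h : ContMDiffOn 𝓘(ℝ, E) 𝓘(ℝ, E) ∞ e.symm e.target :=
    contMDiffOn_symm_of_mem_maximalAtlas (IsManifold.subset_maximalAtlas he)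
  exact (hρ.comp_contMDiffOn h).contDiffOn

/-- The product of a function and a form. -/
def smulForm {r : ℕ} (ρ : M → ℝ) (α : Form E M r) : Form E M r := fun x => ρ x • α x

theorem chartForm_smulForm {r : ℕ} (ρ : M → ℝ) (α : Form E M r) (e : OpenPartialHomeomorph M E)
    (y : E) : chartForm e (smulForm ρ α) y = ρ (e.symm y) • chartForm e α y := rfl

theorem isSmooth_smulForm {r : ℕ} {ρ : M → ℝ} (hρ : ContMDiff 𝓘(ℝ, E) 𝓘(ℝ, ℝ) ∞ ρ)
    {α : Form E M r} (hα : IsSmooth α) : IsSmooth (smulForm ρ α) :=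
  fun e he => by
    change ContDiffOn ℝ ∞ (fun y => ρ (e.symm y) • chartForm e α y) e.target
    exact (contDiffOn_comp_symm hρ he).smul (hα e he)

/-- `d` is local and `ρα` vanishes on the open complement of the closed support. -/
theorem d_smulForm_eq_zero {r : ℕ} {ρ : M → ℝ} (α : Form E M r) {x : M} (hx : x ∉ tsupport ρ) :
    d (smulForm ρ α) x = 0 := by
  have h : chartForm (chartAt E x) (smulForm ρ α) =ᶠ[𝓝 (chartAt E x x)] fun _ => 0 := by
    have hc := (chartAt E x).symm.continuousAt
      ((chartAt E x).map_source (mem_chart_source E x))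
    have hx' : (tsupport ρ)ᶜ ∈ 𝓝 ((chartAt E x).symm (chartAt E x x)) := by
      rw [(chartAt E x).left_inv (mem_chart_source E x)]
      exact (isClosed_tsupport ρ).isOpen_compl.mem_nhds hx
    filter_upwards [hc.preimage_mem_nhds hx'] with z hz
    rw [chartForm_smulForm, image_eq_zero_of_notMem_tsupport hz]
    ext v
    simp
  have h0 : extDeriv (chartForm (chartAt E x) (smulForm ρ α)) (chartAt E x x) = 0 := by
    rw [h.extDeriv_eq]
    ext v
    simp [extDeriv, ContinuousAlternatingMap.alternatizeUncurryFin_apply]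
  unfold d
  rw [h0]
  rfl

theorem sum_d_smulForm {r : ℕ} {ι : Type*} (F : Finset ι) {ρ : ι → M → ℝ}
    (hρ : ∀ i, ContMDiff 𝓘(ℝ, E) 𝓘(ℝ, ℝ) ∞ (ρ i)) (hsum : ∀ x, ∑ i ∈ F, ρ i x = 1)
    {α : Form E M r} (hα : IsSmooth α) (x : M) :
    ∑ i ∈ F, d (smulForm (ρ i) α) x = d α x := by
  set e := chartAt E x
  have he : e ∈ atlas E M := chart_mem_atlas E x
  have hx : e x ∈ e.target := e.map_source (mem_chart_source E x)
  have h1 : chartForm e α = fun y => ∑ i ∈ F, chartForm e (smulForm (ρ i) α) y := by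
    funext y
    simp only [chartForm_smulForm, ← Finset.sum_smul, hsum, one_smul]
  have hdiff (i : ι) : DifferentiableAt ℝ (chartForm e (smulForm (ρ i) α)) (e x) :=
    ((isSmooth_smulForm (hρ i) hα e he).contDiffAt (e.open_target.mem_nhds hx)).differentiableAt
      (by simp)
  have h2 : extDeriv (chartForm e α) (e x) =
      ∑ i ∈ F, extDeriv (chartForm e (smulForm (ρ i) α)) (e x) := by
    rw [h1]
    unfold extDeriv
    rw [fderiv_fun_sum fun i _ => hdiff i]
    exact map_sum (ContinuousAlternatingMap.alternatizeUncurryFinCLM ℝ E ℂ) _ F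
  ext v
  have h3 := congrArg (fun β : E [⋀^Fin (r + 1)]→L[ℝ] ℂ =>
    β (mfderiv 𝓘(ℂ, E) 𝓘(ℂ, E) e x ∘ v)) h2
  simp only [ContinuousAlternatingMap.sum_apply] at h3 ⊢
  exact h3.symm

end Charts

/-! ### Integrals of top forms in charts. -/

section Integration

open MeasureTheory

variable {E : Type*} [NormedAddCommGroup E] [NormedSpace ℂ E]
  {M : Type*} [TopologicalSpace M] [ChartedSpace E M]

/-- The coefficient of a form in a chart with respect to fixed vectors, extended by zero. -/
def chartCoeff {m : ℕ} (v : Fin m → E) (e : OpenPartialHomeomorph M E) (τ : Form E M m) : E → ℂ :=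
  e.target.indicator fun y => chartForm e τ y v

theorem chartCoeff_of_mem {m : ℕ} (v : Fin m → E) {e : OpenPartialHomeomorph M E} (τ : Form E M m)
    {y : E} (hy : y ∈ e.target) : chartCoeff v e τ y = chartForm e τ y v :=
  Set.indicator_of_mem hy _

theorem chartCoeff_of_notMem {m : ℕ} (v : Fin m → E) {e : OpenPartialHomeomorph M E}
    (τ : Form E M m) {y : E} (hy : y ∉ e.target) : chartCoeff v e τ y = 0 :=
  Set.indicator_of_notMem hy _

theorem chartCoeff_eq_zero {m : ℕ} (v : Fin m → E) {e : OpenPartialHomeomorph M E}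
    (τ : Form E M m) {y : E} (hy : formAt τ (e.symm y) = 0) : chartCoeff v e τ y = 0 := by
  by_cases h : y ∈ e.target
  · rw [chartCoeff_of_mem v τ h, chartForm_eq_zero e τ hy]; rfl
  · exact chartCoeff_of_notMem v τ h

theorem chartCoeff_sum {m : ℕ} (v : Fin m → E) (e : OpenPartialHomeomorph M E) {ι : Type*}
    (F : Finset ι) (τ : ι → Form E M m) (σ : Form E M m)
    (h : ∀ x, ∑ i ∈ F, formAt (τ i) x = formAt σ x) (y : E) :
    chartCoeff v e σ y = ∑ i ∈ F, chartCoeff v e (τ i) y := by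
  by_cases hy : y ∈ e.target
  · simp only [chartCoeff_of_mem v _ hy, chartForm_apply, ← h, ContinuousAlternatingMap.sum_apply]
  · simp only [chartCoeff_of_notMem v _ hy, Finset.sum_const_zero]

theorem continuous_chartCoeff [FiniteDimensional ℂ E] {m : ℕ} (v : Fin m → E) {e : OpenPartialHomeomorph M E}
    {τ : Form E M m} (hτ : ContinuousOn (chartForm e τ) e.target) {K : Set M} (hK : IsCompact K)
    (hKe : K ⊆ e.source) (h0 : ∀ x, x ∉ K → formAt τ x = 0) :
    Continuous (chartCoeff v e τ) ∧ HasCompactSupport (chartCoeff v e τ) := by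
  have hK' : IsCompact (e '' K) := hK.image_of_continuousOn (e.continuousOn.mono hKe)
  have hz (y : E) (hy : y ∉ e '' K) : chartCoeff v e τ y = 0 := by
    by_cases hyt : y ∈ e.target
    · exact chartCoeff_eq_zero v τ (h0 _ fun h => hy ⟨_, h, e.right_inv hyt⟩)
    · exact chartCoeff_of_notMem v τ hyt
  refine ⟨continuous_iff_continuousAt.2 fun y => ?_, HasCompactSupport.intro hK' hz⟩
  by_cases hy : y ∈ e '' K
  · have hyt : y ∈ e.target := by
      obtain ⟨x, hx, rfl⟩ := hy
      exact e.map_source (hKe hx)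
    have hn := e.open_target.mem_nhds hyt
    have hc : ContinuousAt (fun z => chartForm e τ z v) y :=
      (evalFormCLM v).continuous.continuousAt.comp (hτ.continuousAt hn)
    refine hc.congr ?_
    filter_upwards [hn] with z hz
    exact (chartCoeff_of_mem v τ hz).symm
  · refine continuousAt_const.congr (f := fun _ => (0 : ℂ)) ?_
    filter_upwards [hK'.isClosed.isOpen_compl.mem_nhds hy] with z h
    exact (hz z h).symm

variable [IsManifold 𝓘(ℂ, E) ω M] [FiniteDimensional ℂ E] [MeasurableSpace E] [BorelSpace E]
  (μ : Measure E) [μ.IsAddHaarMeasure]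

/-- The integral of a top form supported in two charts does not depend on the chart. -/
theorem integral_chartCoeff_eq {n m : ℕ} (hn : Module.finrank ℂ E = n) (hm : m = 2 * n)
    (hn0 : n ≠ 0) (v : Fin m → E) {e e' : OpenPartialHomeomorph M E} (he : e ∈ atlas E M)
    (he' : e' ∈ atlas E M) (τ : Form E M m)
    (h0 : ∀ x, ¬ (x ∈ e.source ∧ x ∈ e'.source) → formAt τ x = 0) :
    ∫ y, chartCoeff v e τ y ∂μ = ∫ y, chartCoeff v e' τ y ∂μ := by
  have : FiniteDimensional ℝ E := FiniteDimensional.complexToReal E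
  let f : OpenPartialHomeomorph E E := e.symm.trans e'
  have hs (y : E) : y ∈ f.source ↔ y ∈ e.target ∧ e.symm y ∈ e'.source := by
    simp [f]
  have ht (y : E) : y ∈ f.target ↔ y ∈ e'.target ∧ e'.symm y ∈ e.source := by
    simp [f]
  have h1 : chartCoeff v e τ = f.source.indicator fun y => chartForm e τ y v := by
    funext y
    by_cases hy : y ∈ f.source
    · rw [Set.indicator_of_mem hy, chartCoeff_of_mem v τ ((hs y).1 hy).1]
    · rw [Set.indicator_of_notMem hy]
      by_cases hy' : y ∈ e.target
      · exact chartCoeff_eq_zero v τ (h0 _ fun h => hy ((hs y).2 ⟨hy', h.2⟩))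
      · exact chartCoeff_of_notMem v τ hy'
  have h2 : chartCoeff v e' τ = f.target.indicator fun y => chartForm e' τ y v := by
    funext y
    by_cases hy : y ∈ f.target
    · rw [Set.indicator_of_mem hy, chartCoeff_of_mem v τ ((ht y).1 hy).1]
    · rw [Set.indicator_of_notMem hy]
      by_cases hy' : y ∈ e'.target
      · exact chartCoeff_eq_zero v τ (h0 _ fun h => hy ((ht y).2 ⟨hy', h.1⟩))
      · exact chartCoeff_of_notMem v τ hy'
  rw [h1, h2, integral_indicator f.open_source.measurableSet,
    integral_indicator f.open_target.measurableSet]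
  have hf' (y : E) (hy : y ∈ f.source) : HasFDerivAt f
      ((fderiv ℂ (fun z => e' (e.symm z)) y).restrictScalars ℝ) y := by
    rw [← fderiv_real_transition he he' ((hs y).1 hy).1 ((hs y).1 hy).2]
    exact (((contDiffAt_transition he he' ((hs y).1 hy).1 ((hs y).1 hy).2).restrict_scalars
      ℝ).differentiableAt (by simp)).hasFDerivAt
  -- The real Jacobian of a holomorphic map is `|det|² ≥ 0`, so the absolute value is harmless and
  -- the Jacobian equals the factor by which the coefficient of a top form changes.
  rw [integral_target_eq_integral_abs_det_fderiv_smul μ hf']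
  refine setIntegral_congr_fun f.open_source.measurableSet fun y hy => ?_
  obtain ⟨hy1, hy2⟩ := (hs y).1 hy
  set A : E →L[ℂ] E := fderiv ℂ (fun z => e' (e.symm z)) y with hA
  have hdet : (A.restrictScalars ℝ).det = Complex.normSq (LinearMap.det (A : E →ₗ[ℂ] E)) :=
    det_restrictScalars_complex (A : E →ₗ[ℂ] E)
  rw [hdet, abs_of_nonneg (Complex.normSq_nonneg _), chartForm_transition he he' hy1 hy2,
    Complex.real_smul]
  exact top_form_comp hn hm hn0 _ (A : E →ₗ[ℂ] E) v

/-- Stokes' theorem in a chart. -/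
theorem integral_chartCoeff_d_eq_zero [T2Space M] [CompactSpace M] {N : ℕ} (v : Fin (N + 1) → E)
    {e : OpenPartialHomeomorph M E} (he : e ∈ atlas E M) {ρ : M → ℝ}
    (hρ : ContMDiff 𝓘(ℝ, E) 𝓘(ℝ, ℝ) ∞ ρ) (hρe : tsupport ρ ⊆ e.source) {α : Form E M N}
    (hα : IsSmooth α) : ∫ y, chartCoeff v e (d (smulForm ρ α)) y ∂μ = 0 := by
  -- Extension by zero is smooth since the image of `tsupport ρ` is a compact subset of the target.
  let Ω : E → E [⋀^Fin N]→L[ℝ] ℂ := e.target.indicator (chartForm e (smulForm ρ α))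
  have hK : IsCompact (e '' tsupport ρ) :=
    (isClosed_tsupport ρ).isCompact.image_of_continuousOn (e.continuousOn.mono hρe)
  have hΩt (y : E) (hy : y ∈ e.target) : Ω =ᶠ[𝓝 y] chartForm e (smulForm ρ α) := by
    filter_upwards [e.open_target.mem_nhds hy] with z hz
    exact Set.indicator_of_mem hz _
  have hΩ0 (y : E) (hy : y ∉ e '' tsupport ρ) : Ω y = 0 := by
    by_cases hyt : y ∈ e.target
    · have hy' : e.symm y ∉ tsupport ρ := fun h => hy ⟨_, h, e.right_inv hyt⟩
      have : Ω y = chartForm e (smulForm ρ α) y := Set.indicator_of_mem hyt _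
      rw [this, chartForm_smulForm, image_eq_zero_of_notMem_tsupport hy']
      ext w
      simp
    · exact Set.indicator_of_notMem hyt _
  have hΩK (y : E) (hy : y ∉ e '' tsupport ρ) : Ω =ᶠ[𝓝 y] fun _ => 0 := by
    filter_upwards [hK.isClosed.isOpen_compl.mem_nhds hy] with z hz
    exact hΩ0 z hz
  have hKt : e '' tsupport ρ ⊆ e.target := by
    rintro _ ⟨x, hx, rfl⟩
    exact e.map_source (hρe hx)
  have hΩ : ContDiff ℝ 1 Ω := by
    refine contDiff_iff_contDiffAt.2 fun y => ?_
    by_cases hy : y ∈ e.target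
    · exact (((isSmooth_smulForm hρ hα e he).contDiffAt (e.open_target.mem_nhds hy)).of_le
        (by simp)).congr_of_eventuallyEq (hΩt y hy)
    · exact contDiffAt_const.congr_of_eventuallyEq (hΩK y fun h => hy (hKt h))
  have key : chartCoeff v e (d (smulForm ρ α)) = fun y => extDeriv Ω y v := by
    funext y
    by_cases hy : y ∈ e.target
    · rw [chartCoeff_of_mem v _ hy, chartForm_d he (isSmooth_smulForm hρ hα) hy,
        (hΩt y hy).extDeriv_eq]
    · rw [chartCoeff_of_notMem v _ hy, (hΩK y fun h => hy (hKt h)).extDeriv_eq]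
      simp [extDeriv, ContinuousAlternatingMap.alternatizeUncurryFin_apply]
  rw [key]
  exact integral_extDeriv_eq_zero μ hΩ (HasCompactSupport.intro hK hΩ0) v

end Integration

/-! ### Global Stokes with a positivity contradiction. -/

section GlobalStokes

open MeasureTheory

variable {E : Type*} [NormedAddCommGroup E] [NormedSpace ℂ E] [FiniteDimensional ℂ E]
  {M : Type*} [TopologicalSpace M] [ChartedSpace E M] [IsManifold 𝓘(ℂ, E) ω M]

/-- On a compact complex manifold, the differential of a smooth form of degree `2n - 1` is not
everywhere a positive multiple of the orientation given by a nonzero constant. -/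
theorem not_forall_d_pos [T2Space M] [CompactSpace M] [Nonempty M] {n N : ℕ}
    (hn : Module.finrank ℂ E = n) (hN : N + 1 = 2 * n) (hn0 : n ≠ 0) {α : Form E M N}
    (hα : IsSmooth α) (v : Fin (N + 1) → E) {c : ℂ} (hc : c ≠ 0)
    (hpos : ∀ e ∈ atlas E M, ∀ y ∈ e.target, ∃ h : ℝ, 0 < h ∧ chartForm e (d α) y v = c * h) :
    False := by
  have : FiniteDimensional ℝ E := FiniteDimensional.complexToReal E
  have : IsManifold 𝓘(ℝ, E) ∞ M := isManifold_real
  let _ : MeasurableSpace E := borel E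
  have : BorelSpace E := ⟨rfl⟩
  let μ : Measure E := Measure.addHaar
  obtain ⟨ρ, hρs⟩ := SmoothPartitionOfUnity.exists_isSubordinate_chartAt_source 𝓘(ℝ, E) M
  -- By compactness only finitely many members of the locally finite partition are nonzero.
  have hfin : {i | (Function.support (ρ i)).Nonempty}.Finite :=
    ρ.locallyFinite.finite_nonempty_of_compact
  let F : Finset M := hfin.toFinset
  have hsum (x : M) : ∑ i ∈ F, ρ i x = 1 := by
    rw [← ρ.sum_eq_one (Set.mem_univ x), finsum_eq_sum_of_support_subset]
    intro i hi
    simp only [F, Set.Finite.coe_toFinset, Set.mem_ofPred_eq]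
    exact ⟨x, hi⟩
  have hρ (i : M) : ContMDiff 𝓘(ℝ, E) 𝓘(ℝ, ℝ) ∞ (ρ i) := (ρ i).contMDiff
  let C : M → OpenPartialHomeomorph M E := fun i => chartAt E i
  have hC (i : M) : C i ∈ atlas E M := chart_mem_atlas E i
  let D : M → Form E M (N + 1) := fun j => d (smulForm (ρ j) α)
  have hD0 (j x : M) (hx : x ∉ tsupport (ρ j)) : formAt (D j) x = 0 := d_smulForm_eq_zero α hx
  have hDc (j : M) (e) (he : e ∈ atlas E M) : ContinuousOn (chartForm e (D j)) e.target :=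
    continuousOn_chartForm_d he (isSmooth_smulForm (hρ j) hα)
  have hcs (i : M) {e : OpenPartialHomeomorph M E} (he : e ∈ atlas E M) {τ : Form E M (N + 1)}
      (hτ : ContinuousOn (chartForm e τ) e.target) :
      ContinuousOn (chartForm e (smulForm (ρ i) τ)) e.target := by
    change ContinuousOn (fun y => ρ i (e.symm y) • chartForm e τ y) e.target
    exact (contDiffOn_comp_symm (hρ i) he).continuousOn.smul hτ
  have hs0 (i x : M) (τ : Form E M (N + 1)) (hx : x ∉ tsupport (ρ i)) :
      formAt (smulForm (ρ i) τ) x = 0 := by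
    change ρ i x • formAt τ x = 0
    rw [image_eq_zero_of_notMem_tsupport hx]
    ext w
    simp
  have hs0' (i x : M) (τ : Form E M (N + 1)) (hx : formAt τ x = 0) :
      formAt (smulForm (ρ i) τ) x = 0 := by
    change ρ i x • formAt τ x = 0
    rw [hx]
    ext w
    simp
  have hcompact (i : M) : IsCompact (tsupport (ρ i)) := (isClosed_tsupport _).isCompact
  have hint1 (i j : M) : Integrable (chartCoeff v (C j) (smulForm (ρ i) (D j))) μ := by
    obtain ⟨h1, h2⟩ := continuous_chartCoeff v (hcs i (hC j) (hDc j _ (hC j))) (hcompact j)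
      (hρs j) (fun x hx => hs0' i x _ (hD0 j x hx))
    exact h1.integrable_of_hasCompactSupport h2
  have hint2 (i j : M) : Integrable (chartCoeff v (C i) (smulForm (ρ i) (D j))) μ := by
    obtain ⟨h1, h2⟩ := continuous_chartCoeff v (hcs i (hC i) (hDc j _ (hC i))) (hcompact i)
      (hρs i) (fun x hx => hs0 i x _ hx)
    exact h1.integrable_of_hasCompactSupport h2
  -- The terms `ρ_i d(ρ_j α)` are summed in both orders. Over `i`, in chart `j`, the sum is `∫ d(ρ_j
  -- α) = 0`; over `j`, in chart `i`, it is `∫ ρ_i dα`. Each term is supported in both charts, so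
  -- its integral is the same in either.
  have hA (j : M) : ∑ i ∈ F, ∫ y, chartCoeff v (C j) (smulForm (ρ i) (D j)) y ∂μ = 0 := by
    rw [← integral_finsetSum _ fun i _ => hint1 i j,
      ← integral_chartCoeff_d_eq_zero μ v (hC j) (hρ j) (hρs j) hα]
    refine integral_congr_ae (Filter.Eventually.of_forall fun y => ?_)
    refine (chartCoeff_sum v (C j) F (fun i => smulForm (ρ i) (D j)) (D j) (fun x => ?_) y).symm
    change ∑ i ∈ F, ρ i x • formAt (D j) x = formAt (D j) x
    rw [← Finset.sum_smul, hsum, one_smul]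
  have hB (i j : M) : ∫ y, chartCoeff v (C j) (smulForm (ρ i) (D j)) y ∂μ =
      ∫ y, chartCoeff v (C i) (smulForm (ρ i) (D j)) y ∂μ := by
    refine integral_chartCoeff_eq μ hn hN hn0 v (hC j) (hC i) _ fun x hx => ?_
    by_cases hxj : x ∈ tsupport (ρ j)
    · exact hs0 i x _ fun hxi => hx ⟨hρs j hxj, hρs i hxi⟩
    · exact hs0' i x _ (hD0 j x hxj)
  have hE (i : M) : ∑ j ∈ F, ∫ y, chartCoeff v (C i) (smulForm (ρ i) (D j)) y ∂μ =
      ∫ y, chartCoeff v (C i) (smulForm (ρ i) (d α)) y ∂μ := by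
    rw [← integral_finsetSum _ fun j _ => hint2 i j]
    refine integral_congr_ae (Filter.Eventually.of_forall fun y => ?_)
    refine (chartCoeff_sum v (C i) F (fun j => smulForm (ρ i) (D j)) (smulForm (ρ i) (d α))
      (fun x => ?_) y).symm
    change ∑ j ∈ F, ρ i x • formAt (D j) x = ρ i x • formAt (d α) x
    rw [← Finset.smul_sum]
    exact congrArg (ρ i x • ·) (sum_d_smulForm F hρ hsum hα x)
  have htotal : ∑ i ∈ F, ∫ y, chartCoeff v (C i) (smulForm (ρ i) (d α)) y ∂μ = 0 := by
    rw [← Finset.sum_congr rfl fun i _ => hE i, Finset.sum_comm,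
      ← Finset.sum_congr rfl fun j _ => Finset.sum_congr rfl fun i _ => hB i j]
    exact Finset.sum_eq_zero fun j _ => hA j
  -- Dividing by `c` turns the integrands into nonnegative real functions, continuous with compact
  -- support, whose integrals sum to zero.
  let g : M → E → ℝ := fun i y => (chartCoeff v (C i) (smulForm (ρ i) (d α)) y / c).re
  have hg (i : M) (y : E) : chartCoeff v (C i) (smulForm (ρ i) (d α)) y = c * g i y ∧ 0 ≤ g i y ∧
      (y ∈ (C i).target → ρ i ((C i).symm y) ≠ 0 → g i y ≠ 0) := by
    by_cases hy : y ∈ (C i).target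
    · obtain ⟨h, hh, he⟩ := hpos (C i) (hC i) y hy
      have h1 : chartCoeff v (C i) (smulForm (ρ i) (d α)) y =
          c * ((ρ i ((C i).symm y) * h : ℝ) : ℂ) := by
        rw [chartCoeff_of_mem v _ hy, chartForm_smulForm, ContinuousAlternatingMap.smul_apply, he,
          Complex.real_smul]
        push_cast
        ring
      have h2 : g i y = ρ i ((C i).symm y) * h := by
        simp only [g]
        rw [h1, mul_div_cancel_left₀ _ hc, Complex.ofReal_re]
      rw [h2]
      exact ⟨h1, mul_nonneg (ρ.nonneg i _) hh.le, fun _ h0 => mul_ne_zero h0 hh.ne'⟩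
    · have h1 := chartCoeff_of_notMem v (smulForm (ρ i) (d α)) hy
      have h2 : g i y = 0 := by simp only [g]; rw [h1]; simp
      rw [h1, h2]
      simp [hy]
  have hgc (i : M) : Continuous (g i) ∧ HasCompactSupport (g i) := by
    obtain ⟨h1, h2⟩ := continuous_chartCoeff v (hcs i (hC i) (continuousOn_chartForm_d (hC i) hα))
      (hcompact i) (hρs i) (fun x hx => hs0 i x _ hx)
    exact ⟨Complex.continuous_re.comp (h1.div_const c),
      h2.comp_left (g := fun z : ℂ => (z / c).re) (by simp)⟩
  have hgi (i : M) : ∫ y, chartCoeff v (C i) (smulForm (ρ i) (d α)) y ∂μ =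
      c * ((∫ y, g i y ∂μ : ℝ) : ℂ) := by
    rw [← integral_complex_ofReal, ← integral_const_mul]
    exact integral_congr_ae (Filter.Eventually.of_forall fun y => (hg i y).1)
  have hzero : ∑ i ∈ F, ∫ y, g i y ∂μ = 0 := by
    simp only [hgi] at htotal
    rw [← Finset.mul_sum, mul_eq_zero, or_iff_right hc] at htotal
    exact_mod_cast htotal
  obtain ⟨x⟩ := ‹Nonempty M›
  obtain ⟨i, hi, hix⟩ : ∃ i ∈ F, ρ i x ≠ 0 := by
    by_contra! h
    have := hsum x
    rw [Finset.sum_eq_zero h] at this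
    exact zero_ne_one this
  have hi0 := (Finset.sum_eq_zero_iff_of_nonneg fun i _ =>
    integral_nonneg fun y => (hg i y).2.1).1 hzero i hi
  have hxs : x ∈ (C i).source := hρs i (subset_tsupport _ hix)
  have hpos' : 0 < ∫ y, g i y ∂μ := by
    refine (hgc i).1.integral_pos_of_hasCompactSupport_nonneg_nonzero (hgc i).2
      (fun y => (hg i y).2.1) (x := C i x) ?_
    refine (hg i (C i x)).2.2 ((C i).map_source hxs) ?_
    rwa [(C i).left_inv hxs]
  exact hpos'.ne' hi0

end GlobalStokes

/-! ### Positivity from transversality. -/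

section Positivity

variable {E : Type*} [NormedAddCommGroup E] [NormedSpace ℂ E]

theorem IsComplexLinear.comp {V W : Type*} [AddCommGroup V] [Module ℂ V] [TopologicalSpace V]
    [IsTopologicalAddGroup V] [ContinuousSMul ℂ V] [AddCommGroup W] [Module ℂ W]
    [TopologicalSpace W] [IsTopologicalAddGroup W] [ContinuousSMul ℂ W] {r : ℕ}
    {β : V [⋀^Fin r]→L[ℝ] ℂ} (hβ : IsComplexLinear β) (A : W →L[ℂ] V) :
    IsComplexLinear (β.compContinuousLinearMap (A.restrictScalars ℝ)) := by
  intro v j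
  have h : A ∘ Function.update v j (Complex.I • v j) =
      Function.update (A ∘ v) j (Complex.I • (A ∘ v) j) :=
    (Function.comp_update _ _ _ _).trans (congrArg (Function.update _ j) (A.map_smul _ _))
  have := hβ (A ∘ v) j
  rw [← h] at this
  exact this

variable [FiniteDimensional ℂ E]

/-- If `Ψ^{p,p}` is transverse and `ξ ≠ 0` is simple, then `Ψ ∧ ξ ∧ ξ̄` is a multiple of the
volume form of a fixed coframe, whose factor is positive up to a universal constant. -/
theorem exists_pos_of_isTransverse {n p : ℕ} (hn : Module.finrank ℂ E = n) (hp : p ≤ n)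
    (hn0 : n ≠ 0) {Ψ : E [⋀^Fin (2 * p)]→L[ℝ] ℂ} (hΨ : IsTransverse n p (typeComponent p p Ψ))
    {ξ : E [⋀^Fin (n - p)]→L[ℝ] ℂ} (hξ : IsSimple ξ) (hξ0 : ξ ≠ 0)
    (φ₀ : Module.Basis (Fin n) ℂ (E →L[ℂ] ℂ)) (hm : n + n = 2 * p + (n - p) + (n - p)) :
    ∃ a : ℝ, 0 < a ∧ ∀ u, wedge (wedge Ψ ξ) (conj ξ) u =
      (sigma (n - p))⁻¹ * (a * volForm (fun i => φ₀ i) (u ∘ Fin.cast hm)) := by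
  obtain ⟨h, φ, a, ha, hτ⟩ := hΨ ξ hξ hξ0
  -- The coframe supplied by transversality may depend on `Ψ` and `ξ`; comparison with `φ₀` makes
  -- the positive multiples comparable across points.
  obtain ⟨b, hb, hφ⟩ := volForm_eq_pos_mul hn0 hn φ φ₀
  refine ⟨a * b, mul_pos ha hb, fun u => ?_⟩
  rw [← wedge_typeComponent hn (Nat.add_sub_cancel' hp) hn0 Ψ hξ.isComplexLinear]
  have h1 : sigma (n - p) * wedge (wedge (typeComponent p p Ψ) ξ) (conj ξ) u = _ := hτ u
  rw [hφ] at h1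
  rw [eq_inv_mul_iff_mul_eq₀ (sigma_ne_zero _), h1]
  push_cast
  rw [mul_assoc]
  rfl

end Positivity

/-! ### Products and closedness of forms on the manifold. -/

section ManifoldForms

variable {E : Type*} [NormedAddCommGroup E] [NormedSpace ℂ E] [FiniteDimensional ℂ E]
  {M : Type*} [TopologicalSpace M] [ChartedSpace E M]

/-- The wedge product of forms on a manifold. -/
def wedgeForm {r s : ℕ} (α : Form E M r) (β : Form E M s) : Form E M (r + s) :=
  fun x => wedge (α x) (β x)

/-- The complex conjugate of a form on a manifold. -/
def conjForm {r : ℕ} (α : Form E M r) : Form E M r := fun x => conj (α x)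

theorem chartForm_wedgeForm {r s : ℕ} (α : Form E M r) (β : Form E M s)
    (e : OpenPartialHomeomorph M E) :
    chartForm e (wedgeForm α β) = fun y => wedge (chartForm e α y) (chartForm e β y) := by
  funext y
  exact wedge_comp (formAt α (e.symm y)) (formAt β (e.symm y)) ((symmDeriv e y).restrictScalars ℝ)

theorem chartForm_conjForm {r : ℕ} (α : Form E M r) (e : OpenPartialHomeomorph M E) :
    chartForm e (conjForm α) = fun y => conj (chartForm e α y) := rfl

theorem isSmooth_wedgeForm {r s : ℕ} {α : Form E M r} {β : Form E M s} (hα : IsSmooth α)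
    (hβ : IsSmooth β) : IsSmooth (wedgeForm α β) := by
  intro e he
  rw [chartForm_wedgeForm]
  exact ((wedgeCLM E r s).contDiff.comp_contDiffOn (hα e he)).clm_apply (hβ e he)

theorem isSmooth_conjForm {r : ℕ} {α : Form E M r} (hα : IsSmooth α) : IsSmooth (conjForm α) := by
  intro e he
  rw [chartForm_conjForm]
  exact (conjFormCLM E r).contDiff.comp_contDiffOn (hα e he)

theorem IsSmooth.differentiableAt {r : ℕ} {α : Form E M r} (hα : IsSmooth α)
    {e : OpenPartialHomeomorph M E} (he : e ∈ atlas E M) {y : E} (hy : y ∈ e.target) :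
    DifferentiableAt ℝ (chartForm e α) y :=
  ((hα e he).contDiffAt (e.open_target.mem_nhds hy)).differentiableAt (by simp)

/-- A smooth simple form with `∂ξ = 0` and `∂̄ξ = 0` is closed. -/
theorem d_eq_zero_of_del_delbar {k : ℕ} {ξ : Form E M k} (hξ : IsSmooth ξ)
    (hs : ∀ x, IsSimple (ξ x)) {x : M} (h1 : del k 0 ξ x = 0) (h2 : delbar k 0 ξ x = 0) :
    d ξ x = 0 := by
  have hx := (chartAt E x).map_source (mem_chart_source E x)
  refine comp_extDeriv_eq_zero (hξ.differentiableAt (chart_mem_atlas E x) hx)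
    (Filter.Eventually.of_forall fun z => ?_) (mfderiv 𝓘(ℂ, E) 𝓘(ℂ, E) (chartAt E x) x) (d ξ x)
    (fun v => rfl) h1 h2
  exact IsComplexLinear.comp (hs _).isComplexLinear
    (mfderiv 𝓘(ℂ, E) 𝓘(ℂ, E) (chartAt E x).symm z)

variable [IsManifold 𝓘(ℂ, E) ω M]

/-- The derivative of `e` is a left inverse, as `e ∘ e.symm` is locally the identity. -/
theorem det_symmDeriv_ne_zero {e : OpenPartialHomeomorph M E} (he : e ∈ atlas E M) {y : E}
    (hy : y ∈ e.target) : LinearMap.det (symmDeriv e y : E →ₗ[ℂ] E) ≠ 0 := by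
  intro h0
  obtain ⟨w, hw, hw0⟩ := (Submodule.ne_bot_iff _).1 (LinearMap.bot_lt_ker_of_det_eq_zero h0).ne'
  have hw' : symmDeriv e y w = 0 := hw
  have h1 := mfderiv_comp_symmDeriv he he hy (e.map_target hy) w
  have h2 : (fun z => e (e.symm z)) =ᶠ[𝓝 y] id := by
    filter_upwards [e.open_target.mem_nhds hy] with z hz
    exact e.right_inv hz
  rw [h2.fderiv_eq, fderiv_id, hw'] at h1
  exact hw0 (h1.symm.trans (map_zero _))

/-- If `Ψ = dη` and `ξ` is closed, then `d(η ∧ ξ ∧ ξ̄) = Ψ ∧ ξ ∧ ξ̄`, in a chart. -/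
theorem chartForm_d_wedgeForm {s k q : ℕ} {η : Form E M s} {ξ : Form E M k} {Ψ : Form E M q}
    (hq : q = s + 1) (hη : IsSmooth η) (hξ : IsSmooth ξ) (hdξ : ∀ x, d ξ x = 0)
    (hd : ∀ (x : M) (v : Fin (s + 1) → E), formAt (d η) x v = formAt Ψ x (v ∘ Fin.cast hq))
    {e : OpenPartialHomeomorph M E} (he : e ∈ atlas E M) {y : E} (hy : y ∈ e.target)
    (v : Fin (s + k + k + 1) → E) :
    chartForm e (d (wedgeForm (wedgeForm η ξ) (conjForm ξ))) y v =
      wedge (wedge (formAt Ψ (e.symm y)) (formAt ξ (e.symm y))) (conj (formAt ξ (e.symm y)))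
        (symmDeriv e y ∘ v ∘ Fin.cast (by omega)) := by
  have hηξ := isSmooth_wedgeForm hη hξ
  have hcξ := isSmooth_conjForm hξ
  have h1 : extDeriv (chartForm e ξ) y = 0 := by
    rw [← chartForm_d he hξ hy]
    exact chartForm_eq_zero e _ (hdξ _)
  have h2 : extDeriv (chartForm e (conjForm ξ)) y = 0 := by
    rw [chartForm_conjForm, extDeriv_conj (hξ.differentiableAt he hy), h1]
    ext w
    simp
  have h3 (w : Fin (s + 1) → E) : extDeriv (chartForm e η) y w =
      chartForm e Ψ y (fun i => w (Fin.cast hq i)) := by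
    rw [← chartForm_d he hη hy, chartForm_apply, hd, chartForm_apply]
    rfl
  have h4 (w : Fin (s + k + 1) → E) : extDeriv (chartForm e (wedgeForm η ξ)) y w =
      wedge (chartForm e Ψ y) (chartForm e ξ y) (fun i => w (Fin.cast (by omega) i)) := by
    rw [chartForm_wedgeForm, extDeriv_wedge_of_closed (hη.differentiableAt he hy)
      (hξ.differentiableAt he hy) h1]
    exact wedge_congr_cast hq.symm (chartForm e Ψ y) _ h3 (chartForm e ξ y) _
  rw [chartForm_d he (isSmooth_wedgeForm hηξ hcξ) hy, chartForm_wedgeForm,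
    extDeriv_wedge_of_closed (hηξ.differentiableAt he hy) (hcξ.differentiableAt he hy) h2]
  have h5 := wedge_congr_cast (by omega) (wedge (chartForm e Ψ y) (chartForm e ξ y)) _ h4
    (conj (chartForm e ξ y)) (v ∘ Fin.cast (by omega))
  refine h5.trans ?_
  have h6 : chartForm e Ψ y = (formAt Ψ (e.symm y)).compContinuousLinearMap
    ((symmDeriv e y).restrictScalars ℝ) := rfl
  have h7 : chartForm e ξ y = (formAt ξ (e.symm y)).compContinuousLinearMap
    ((symmDeriv e y).restrictScalars ℝ) := rfl
  rw [h6, h7, ← conj_comp, ← wedge_comp, ← wedge_comp,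
    ContinuousAlternatingMap.compContinuousLinearMap_apply]
  rfl

end ManifoldForms

end PSymp

end

/-! ### The main theorem. -/

theorem mainTheorem6 {E : Type*} [NormedAddCommGroup E] [NormedSpace ℂ E] [FiniteDimensional ℂ E]
    {M : Type*} [TopologicalSpace M] [ChartedSpace E M] [IsManifold 𝓘(ℂ, E) ω M]
    [T2Space M] [CompactSpace M] [Nonempty M]
    (n p k : ℕ) (hn : Module.finrank ℂ E = n) (hp : 1 ≤ p) (hpn : p ≤ n - 1) (hk : k = n - p)
    (Ψ : PSymp.Form E M (2 * p)) (hΨ : PSymp.IsPSymplectic n p Ψ) (hexact : PSymp.IsExact Ψ) :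
    ¬ ∃ ξ : PSymp.Form E M k, PSymp.IsSmooth ξ ∧
      (∀ x, PSymp.typeComponent k 0 (ξ x) = ξ x) ∧
      (∀ x, PSymp.IsSimple (ξ x)) ∧ (∀ x, ξ x ≠ 0) ∧
      (∀ x, PSymp.del k 0 ξ x = 0) ∧ (∀ x, PSymp.delbar k 0 ξ x = 0) := by
  rintro ⟨ξ, hξ, -, hsimple, hξ0, hdel, hdelbar⟩
  obtain ⟨s, hs, η, hη, hd⟩ := hexact
  subst hk
  have hn0 : n ≠ 0 := by omega
  -- Here `s = 2p - 1`, so `η ∧ ξ ∧ ξ̄` has degree `2n - 1`.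
  have hN : s + (n - p) + (n - p) + 1 = 2 * n := by omega
  have hdξ (x : M) : PSymp.d ξ x = 0 :=
    PSymp.d_eq_zero_of_del_delbar hξ hsimple (hdel x) (hdelbar x)
  have hdual : Module.finrank ℂ (E →L[ℂ] ℂ) = n := by
    rw [← (LinearMap.toContinuousLinearMap (𝕜 := ℂ) (E := E) (F' := ℂ)).finrank_eq]
    exact Subspace.dual_finrank_eq.trans hn
  let φ₀ : Module.Basis (Fin n) ℂ (E →L[ℂ] ℂ) := Module.finBasisOfFinrankEq ℂ _ hdual
  -- One coframe of the model space and one tuple `u` serve at all points, every tangent space being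
  -- a copy of `E`. The coframe need not vary smoothly, since only pointwise positivity is used.
  obtain ⟨u, hu⟩ : ∃ u, PSymp.volForm (fun i => φ₀ i) u ≠ 0 := by
    by_contra! h
    exact PSymp.volForm_ne_zero φ₀ (ContinuousAlternatingMap.ext h)
  refine PSymp.not_forall_d_pos hn hN hn0
    (PSymp.isSmooth_wedgeForm (PSymp.isSmooth_wedgeForm hη hξ) (PSymp.isSmooth_conjForm hξ))
    (u ∘ Fin.cast (by omega)) (mul_ne_zero (inv_ne_zero (PSymp.sigma_ne_zero (n - p))) hu)
    fun e he y hy => ?_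
  obtain ⟨a, ha, h⟩ := PSymp.exists_pos_of_isTransverse hn (by omega) hn0
    (Ψ := PSymp.formAt Ψ (e.symm y)) (hΨ.transverse (e.symm y))
    (ξ := PSymp.formAt ξ (e.symm y)) (hsimple _) (hξ0 _) φ₀ (by omega)
  -- `a` comes from transversality, and `|det|²` from pulling the volume form back through the
  -- inverse chart.
  refine ⟨a * Complex.normSq (LinearMap.det (PSymp.symmDeriv e y : E →ₗ[ℂ] E)),
    mul_pos ha (Complex.normSq_pos.2 (PSymp.det_symmDeriv_ne_zero he hy)), ?_⟩
  rw [PSymp.chartForm_d_wedgeForm hs hη hξ hdξ hd he hy, h]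
  have hdet := PSymp.top_form_comp hn (by omega) hn0 (PSymp.volForm fun i => φ₀ i)
    (PSymp.symmDeriv e y : E →ₗ[ℂ] E) u
  push_cast
  refine (congrArg (fun t => (PSymp.sigma (n - p))⁻¹ * (a * t)) hdet).trans ?_
  ring
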